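/- Let $\mathscr V$ be a symmetric monoidal closed category that is locally presentable, and let $\mathscr V\text{-}\mathrm{Cat}$ be the 2-category of small $\mathscr V$-categories, $\mathscr V$-functors and $\mathscr V$-natural transformations; $0$ denotes an initial object of $\mathscr V$. A coslice of a span $A\xleftarrow{u}C\xrightarrow{v}B$ in a bicategory $\mathscr K$ is an object $u{\uparrow}v$ with morphisms $i:A\to u{\uparrow}v$, $j:B\to u{\uparrow}v$ and a 2-cell $\gamma: i\circ u\Rightarrow j\circ v$ such that, for every $X$, pasting with it is an equivalence from $\mathscr K(u{\uparrow}v,X)$ to the comma category $\mathscr K(u,X)\downarrow\mathscr K(v,X)$. A morphism $u:C\to A$ is a cofibration when the canonical morphism $\bar u: C{\uparrow}u\to A{\uparrow}A$ (where $C{\uparrow}u=1_C{\uparrow}u$ and $A{\uparrow}A=1_A{\uparrow}1_A$), induced by $i_A\circ u$, $j_A$ and the 2-cell $\gamma_A u:i_A\circ u\Rightarrow j_A\circ u$ of $A{\uparrow}A$, has a left adjoint with invertible counit. It is a coopfibration when it is a cofibration in $\mathscr K^{\mathrm{co}}$, that is, when the canonical morphism $u{\uparrow}C\to A{\uparrow}A$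 (where $u{\uparrow}C=u{\uparrow}1_C$) has a right adjoint with invertible unit. A full sub-$\mathscr V$-category $A$ of $X$ is a sieve when $X(x,a)\cong 0$ for all $a\in A$ and $x\notin A$, and an opsieve when $X(a,x)\cong 0$ for all $a\in A$ and $x\notin A$. Morphisms $f:A\to X$ and $g:A\to Y$ are equivalent under $A$ when there is an equivalence $e:X\to Y$ with $e\circ f\cong g$. Then: 1. every cofibration in $\mathscr V\text{-}\mathrm{Cat}$ is a fully faithful $\mathscr V$-functor; 2. every cofibration $A\to X$ in $\mathscr V\text{-}\mathrm{Cat}$ is equivalent under $A$ to the inclusion $A\hookrightarrow Y$ of a sieve; 3. every coopfibration $C\to Y$ in $\mathscr V\text{-}\mathrm{Cat}$ is equivalent under $C$ to the inclusion $C\hookrightarrow Z$ of an opsieve. -/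

import Mathlib

open CategoryTheory

universe w v u

/-! ### The 2-category of small `V`-categories

Mathlib's `EnrichedCategory` and `EnrichedFunctor` are the usual `V`-categories and `V`-functors.
The 2-cells of Mathlib's `EnrichedCat` are only natural on underlying ordinary categories, so the
2-category with genuine `V`-natural transformations is built here. -/

section Whisker

open MonoidalCategory

variable {V : Type v} [Category.{w} V] [MonoidalCategory V]
  {C : Type*} [EnrichedCategory V C] {D : Type*} [EnrichedCategory V D]

/-- Composition of underlying morphisms `𝟙_ V ⟶ C(a, b)` and `𝟙_ V ⟶ C(b, c)`. -/
def elComp {a b c : C} (f : 𝟙_ V ⟶ (a ⟶[V] b)) (g : 𝟙_ V ⟶ (b ⟶[V] c)) :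
    𝟙_ V ⟶ (a ⟶[V] c) :=
  (λ_ (𝟙_ V)).inv ≫ (f ⊗ₘ g) ≫ eComp V a b c

/-- `C(f, z) : C(b, z) ⟶ C(a, z)` for an underlying morphism `f : a ⟶ b`. -/
def elPre {a b : C} (f : 𝟙_ V ⟶ (a ⟶[V] b)) (z : C) : (b ⟶[V] z) ⟶ (a ⟶[V] z) :=
  (λ_ (b ⟶[V] z)).inv ≫ f ▷ (b ⟶[V] z) ≫ eComp V a b z

/-- `C(z, f) : C(z, a) ⟶ C(z, b)` for an underlying morphism `f : a ⟶ b`. -/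
def elPost {a b : C} (f : 𝟙_ V ⟶ (a ⟶[V] b)) (z : C) : (z ⟶[V] a) ⟶ (z ⟶[V] b) :=
  (ρ_ (z ⟶[V] a)).inv ≫ (z ⟶[V] a) ◁ f ≫ eComp V z a b

theorem elComp_eq_post {a b c : C} (f : 𝟙_ V ⟶ (a ⟶[V] b)) (g : 𝟙_ V ⟶ (b ⟶[V] c)) :
    elComp f g = f ≫ elPost g a := by
  rw [elComp, elPost, rightUnitor_inv_naturality_assoc, unitors_inv_equal,
    MonoidalCategory.tensorHom_def, Category.assoc]

theorem elComp_eq_pre {a b c : C} (f : 𝟙_ V ⟶ (a ⟶[V] b)) (g : 𝟙_ V ⟶ (b ⟶[V] c)) :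
    elComp f g = g ≫ elPre f c := by
  rw [elComp, elPre, leftUnitor_inv_naturality_assoc,
    MonoidalCategory.tensorHom_def', Category.assoc]

theorem elPre_id (a z : C) : elPre (eId V a) z = 𝟙 _ := by
  simp [elPre]

theorem elPost_id (a z : C) : elPost (eId V a) z = 𝟙 _ := by
  simp [elPost]

theorem elPost_elPre {a b c d : C} (f : 𝟙_ V ⟶ (a ⟶[V] b)) (g : 𝟙_ V ⟶ (c ⟶[V] d)) :
    elPost g b ≫ elPre f d = elPre f c ≫ elPost g a := by
  simp only [elPost, elPre, Category.assoc]
  rw [leftUnitor_inv_naturality_assoc (eComp V b c d), MonoidalCategory.whisker_exchange_assoc,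
    ← e_assoc, rightUnitor_inv_naturality_assoc (eComp V a b c),
    ← MonoidalCategory.whisker_exchange_assoc,
    rightUnitor_inv_naturality_assoc (f ▷ (b ⟶[V] c)),
    ← MonoidalCategory.whisker_exchange_assoc]
  monoidal

theorem elPost_elComp {a b c : C} (f : 𝟙_ V ⟶ (a ⟶[V] b)) (g : 𝟙_ V ⟶ (b ⟶[V] c)) (z : C) :
    elPost (elComp f g) z = elPost f z ≫ elPost g z := by
  rw [elComp_eq_post]
  simp only [elPost, Category.assoc, MonoidalCategory.whiskerLeft_comp]
  rw [← e_assoc, rightUnitor_inv_naturality_assoc, rightUnitor_inv_naturality_assoc,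
    ← MonoidalCategory.whisker_exchange_assoc]
  monoidal

theorem elPre_elComp {a b c : C} (f : 𝟙_ V ⟶ (a ⟶[V] b)) (g : 𝟙_ V ⟶ (b ⟶[V] c)) (z : C) :
    elPre (elComp f g) z = elPre g z ≫ elPre f z := by
  rw [elComp_eq_pre]
  simp only [elPre, Category.assoc, MonoidalCategory.comp_whiskerRight]
  rw [leftUnitor_inv_naturality_assoc, leftUnitor_inv_naturality_assoc,
    MonoidalCategory.whisker_exchange_assoc, ← e_assoc]
  monoidal

theorem elPost_map (F : EnrichedFunctor V C D) {a b : C} (f : 𝟙_ V ⟶ (a ⟶[V] b)) (z : C) :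
    elPost f z ≫ F.map z b = F.map z a ≫ elPost (f ≫ F.map a b) (F.obj z) := by
  simp only [elPost, Category.assoc, EnrichedFunctor.map_comp, MonoidalCategory.tensorHom_def',
    MonoidalCategory.whiskerLeft_comp, rightUnitor_inv_naturality_assoc (F.map z a),
    ← MonoidalCategory.whisker_exchange_assoc]

theorem elPre_map (F : EnrichedFunctor V C D) {a b : C} (f : 𝟙_ V ⟶ (a ⟶[V] b)) (z : C) :
    elPre f z ≫ F.map a z = F.map b z ≫ elPre (f ≫ F.map a b) (F.obj z) := by
  simp only [elPre, Category.assoc, EnrichedFunctor.map_comp, MonoidalCategory.tensorHom_def,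
    MonoidalCategory.comp_whiskerRight, leftUnitor_inv_naturality_assoc (F.map b z),
    MonoidalCategory.whisker_exchange_assoc]

end Whisker

/-- A small `V`-category (with a `u`-small set of objects). -/
structure VCat (V : Type v) [Category.{w} V] [MonoidalCategory V] where
  /-- The objects. -/
  carrier : Type u
  /-- The hom-objects, identities and composition. -/
  [str : EnrichedCategory V carrier]

namespace VCat

open MonoidalCategory

variable {V : Type v} [Category.{w} V] [MonoidalCategory V]

instance : CoeSort (VCat.{w, v, u} V) (Type u) := ⟨carrier⟩

instance (A : VCat.{w, v, u} V) : EnrichedCategory V A := A.str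

/-- A `V`-functor between small `V`-categories. -/
structure Fun (A B : VCat.{w, v, u} V) where
  /-- The `V`-functor. -/
  toFun : EnrichedFunctor V A B

/-- The object part of a `V`-functor. -/
abbrev Fun.obj {A B : VCat.{w, v, u} V} (F : Fun A B) (a : A) : B := F.toFun.obj a

/-- The hom part of a `V`-functor. -/
abbrev Fun.map {A B : VCat.{w, v, u} V} (F : Fun A B) (a b : A) :
    (a ⟶[V] b) ⟶ (F.obj a ⟶[V] F.obj b) := F.toFun.map a b

/-- A `V`-natural transformation. The two sides of the naturality equation are the composites
`A(a, b) ⟶ B(F a, F b) ⟶ B(F a, G b)` and `A(a, b) ⟶ B(G a, G b) ⟶ B(F a, G b)`. -/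
@[ext]
structure NatTrans {A B : VCat.{w, v, u} V} (F G : Fun A B) where
  /-- The components. -/
  app : ∀ a : A, 𝟙_ V ⟶ (F.obj a ⟶[V] G.obj a)
  naturality : ∀ a b : A,
    F.map a b ≫ elPost (app b) (F.obj a) = G.map a b ≫ elPre (app a) (G.obj b)

instance {A B : VCat.{w, v, u} V} : Category (Fun A B) where
  Hom F G := NatTrans F G
  id F :=
    { app := fun a => eId V (F.obj a)
      naturality := fun a b => by rw [elPost_id, elPre_id] }
  comp {F G H} α β :=
    { app := fun a => elComp (α.app a) (β.app a)
      naturality := fun a b => by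
        rw [elPost_elComp, elPre_elComp, ← Category.assoc, α.naturality, Category.assoc,
          ← elPost_elPre, ← Category.assoc, β.naturality, Category.assoc] }
  id_comp {F _} α := NatTrans.ext (funext fun a =>
    (elComp_eq_pre (eId V (F.obj a)) (α.app a)).trans (by rw [elPre_id, Category.comp_id]))
  comp_id {_ G} α := NatTrans.ext (funext fun a =>
    (elComp_eq_post (α.app a) (eId V (G.obj a))).trans (by rw [elPost_id, Category.comp_id]))
  assoc α β γ := NatTrans.ext (funext fun a => by
    change elComp (elComp (α.app a) (β.app a)) (γ.app a) =
      elComp (α.app a) (elComp (β.app a) (γ.app a))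
    rw [elComp_eq_post, elComp_eq_post, elComp_eq_post (α.app a), elPost_elComp, Category.assoc])

section

variable {A B C D : VCat.{w, v, u} V}

@[ext]
theorem hom_ext {F G : Fun A B} {α β : F ⟶ G} (h : ∀ a, NatTrans.app α a = NatTrans.app β a) :
    α = β :=
  NatTrans.ext (funext h)

@[simp]
theorem id_app (F : Fun A B) (a : A) : NatTrans.app (𝟙 F) a = eId V (F.obj a) := rfl

@[simp]
theorem comp_app {F G H : Fun A B} (α : F ⟶ G) (β : G ⟶ H) (a : A) :
    NatTrans.app (α ≫ β) a = elComp (NatTrans.app α a) (NatTrans.app β a) := rfl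

/-- The identity `V`-functor. -/
def Fun.id (A : VCat.{w, v, u} V) : Fun A A := ⟨EnrichedFunctor.id V A⟩

/-- Composition of `V`-functors, in diagrammatic order. -/
def Fun.comp (F : Fun A B) (G : Fun B C) : Fun A C := ⟨F.toFun.comp V G.toFun⟩

/-- Whiskering of a `V`-natural transformation with a `V`-functor before it. -/
def whiskerL (F : Fun A B) {G H : Fun B C} (α : G ⟶ H) : F.comp G ⟶ F.comp H where
  app a := NatTrans.app α (F.obj a)
  naturality a b := by
    have h := congrArg (F.map a b ≫ ·) (NatTrans.naturality α (F.obj a) (F.obj b))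
    exact (Category.assoc _ _ _).trans (h.trans (Category.assoc _ _ _).symm)

/-- Whiskering of a `V`-natural transformation with a `V`-functor after it. -/
def whiskerR {F G : Fun A B} (α : F ⟶ G) (H : Fun B C) : F.comp H ⟶ G.comp H where
  app a := NatTrans.app α a ≫ H.map _ _
  naturality a b := by
    change (F.map a b ≫ H.map _ _) ≫ elPost (NatTrans.app α b ≫ H.map _ _) (H.obj (F.obj a)) =
      (G.map a b ≫ H.map _ _) ≫ elPre (NatTrans.app α a ≫ H.map _ _) (H.obj (G.obj b))
    rw [Category.assoc, Category.assoc, ← elPost_map, ← elPre_map, ← Category.assoc,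
      NatTrans.naturality α a b, Category.assoc]

theorem map_elComp (H : Fun A B) {a b c : A} (f : 𝟙_ V ⟶ (a ⟶[V] b)) (g : 𝟙_ V ⟶ (b ⟶[V] c)) :
    elComp f g ≫ H.map a c = elComp (f ≫ H.map a b) (g ≫ H.map b c) := by
  rw [elComp_eq_post, Category.assoc, elPost_map, elComp_eq_post, Category.assoc]

theorem elComp_eId {a b : A} (f : 𝟙_ V ⟶ (a ⟶[V] b)) : elComp f (eId V b) = f := by
  rw [elComp_eq_post, elPost_id, Category.comp_id]

theorem eId_elComp {a b : A} (f : 𝟙_ V ⟶ (a ⟶[V] b)) : elComp (eId V a) f = f := by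
  rw [elComp_eq_pre, elPre_id, Category.comp_id]

/-- The associativity isomorphism; its components are identities. -/
def assocIso (F : Fun A B) (G : Fun B C) (H : Fun C D) :
    (F.comp G).comp H ≅ F.comp (G.comp H) where
  hom :=
    { app := fun a => eId V (H.obj (G.obj (F.obj a)))
      naturality := fun a b => by
        change ((F.map a b ≫ G.map _ _) ≫ H.map _ _) ≫
            elPost (eId V (H.obj (G.obj (F.obj b)))) (H.obj (G.obj (F.obj a))) =
          (F.map a b ≫ (G.map _ _ ≫ H.map _ _)) ≫
            elPre (eId V (H.obj (G.obj (F.obj a)))) (H.obj (G.obj (F.obj b)))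
        rw [elPost_id, elPre_id, Category.assoc (F.map a b)] }
  inv :=
    { app := fun a => eId V (H.obj (G.obj (F.obj a)))
      naturality := fun a b => by
        change (F.map a b ≫ (G.map _ _ ≫ H.map _ _)) ≫
            elPost (eId V (H.obj (G.obj (F.obj b)))) (H.obj (G.obj (F.obj a))) =
          ((F.map a b ≫ G.map _ _) ≫ H.map _ _) ≫
            elPre (eId V (H.obj (G.obj (F.obj a)))) (H.obj (G.obj (F.obj b)))
        rw [elPost_id, elPre_id, ← Category.assoc (F.map a b) (G.map _ _)] }
  hom_inv_id := hom_ext fun _ => eId_elComp _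
  inv_hom_id := hom_ext fun _ => eId_elComp _

/-- The left unit isomorphism; its components are identities. -/
def leftIso (F : Fun A B) : (Fun.id A).comp F ≅ F where
  hom :=
    { app := fun a => eId V (F.obj a)
      naturality := fun a b => by
        change (𝟙 _ ≫ F.map a b) ≫ elPost (eId V (F.obj b)) (F.obj a) =
          F.map a b ≫ elPre (eId V (F.obj a)) (F.obj b)
        rw [elPost_id, elPre_id, Category.id_comp] }
  inv :=
    { app := fun a => eId V (F.obj a)
      naturality := fun a b => by
        change F.map a b ≫ elPost (eId V (F.obj b)) (F.obj a) =
          (𝟙 _ ≫ F.map a b) ≫ elPre (eId V (F.obj a)) (F.obj b)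
        rw [elPost_id, elPre_id, Category.id_comp] }
  hom_inv_id := hom_ext fun _ => eId_elComp _
  inv_hom_id := hom_ext fun _ => eId_elComp _

/-- The right unit isomorphism; its components are identities. -/
def rightIso (F : Fun A B) : F.comp (Fun.id B) ≅ F where
  hom :=
    { app := fun a => eId V (F.obj a)
      naturality := fun a b => by
        change (F.map a b ≫ 𝟙 _) ≫ elPost (eId V (F.obj b)) (F.obj a) =
          F.map a b ≫ elPre (eId V (F.obj a)) (F.obj b)
        rw [elPost_id, elPre_id, Category.comp_id] }
  inv :=
    { app := fun a => eId V (F.obj a)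
      naturality := fun a b => by
        change F.map a b ≫ elPost (eId V (F.obj b)) (F.obj a) =
          (F.map a b ≫ 𝟙 _) ≫ elPre (eId V (F.obj a)) (F.obj b)
        rw [elPost_id, elPre_id, Category.comp_id, Category.comp_id] }
  hom_inv_id := hom_ext fun _ => eId_elComp _
  inv_hom_id := hom_ext fun _ => eId_elComp _

end

/-- The 2-category `V`-Cat of small `V`-categories, `V`-functors and `V`-natural
transformations. -/
instance : Bicategory (VCat.{w, v, u} V) where
  Hom A B := Fun A B
  id A := Fun.id A
  comp F G := F.comp G
  whiskerLeft F _ _ α := whiskerL F α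
  whiskerRight α H := whiskerR α H
  associator := assocIso
  leftUnitor := leftIso
  rightUnitor := rightIso
  whiskerLeft_id _ _ := rfl
  whiskerLeft_comp _ _ _ _ _ _ := rfl
  id_whiskerLeft _ := by
    apply hom_ext; intro a
    exact ((eId_elComp _).trans (elComp_eId _)).symm
  comp_whiskerLeft _ _ _ _ _ := by
    apply hom_ext; intro a
    exact ((eId_elComp _).trans (elComp_eId _)).symm
  id_whiskerRight F G := by
    apply hom_ext; intro a
    exact G.toFun.map_id _
  comp_whiskerRight α β H := by
    apply hom_ext; intro a
    exact map_elComp H (NatTrans.app α a) (NatTrans.app β a)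
  whiskerRight_id α := by
    apply hom_ext; intro a
    refine Eq.trans ?_ ((eId_elComp _).trans (elComp_eId _)).symm
    exact Category.comp_id (NatTrans.app α a)
  whiskerRight_comp α G H := by
    apply hom_ext; intro a
    refine Eq.trans ?_ ((eId_elComp _).trans (elComp_eId _)).symm
    exact (Category.assoc (NatTrans.app α a) (G.map _ _) (H.map _ _)).symm
  whisker_assoc _ _ _ _ _ := by
    apply hom_ext; intro a
    exact ((eId_elComp _).trans (elComp_eId _)).symm
  whisker_exchange {_ _ _ F G H I} α β := by
    apply hom_ext; intro a
    have h := congrArg (NatTrans.app α a ≫ ·) (NatTrans.naturality β (F.obj a) (G.obj a))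
    change elComp (NatTrans.app β (F.obj a)) (NatTrans.app α a ≫ I.map _ _) =
      elComp (NatTrans.app α a ≫ H.map _ _) (NatTrans.app β (G.obj a))
    rw [elComp_eq_pre, elComp_eq_post, Category.assoc, Category.assoc]
    exact h.symm
  pentagon F G H I := by
    apply hom_ext; intro a
    change elComp (eId V (H.obj (G.obj (F.obj a))) ≫ I.map _ _)
        (elComp (eId V (I.obj (H.obj (G.obj (F.obj a))))) (eId V _)) =
      elComp (eId V _) (eId V _)
    rw [elComp_eId, elComp_eId]
    exact I.toFun.map_id _
  triangle F G := by
    apply hom_ext; intro a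
    change elComp (eId V (G.obj (F.obj a))) (eId V _) = eId V (F.obj a) ≫ G.map _ _
    rw [elComp_eId]
    exact (G.toFun.map_id _).symm

end VCat

/-! ### Coslices, cofibrations and coopfibrations in a bicategory -/

namespace CategoryTheory.Bicategory

universe w' v' u'

variable {K : Type u'} [Bicategory.{w', v'} K] {A B C : K}

/-- A square under the span `A ⟵ C ⟶ B` given by `u : C ⟶ A` and `v : C ⟶ B`: morphisms
`inl : A ⟶ pt`, `inr : B ⟶ pt` and a 2-cell `inl ∘ u ⟶ inr ∘ v`. -/
structure LaxSquare (u : C ⟶ A) (v : C ⟶ B) where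
  /-- The vertex. -/
  pt : K
  /-- The coprojection from `A`. -/
  inl : A ⟶ pt
  /-- The coprojection from `B`. -/
  inr : B ⟶ pt
  /-- The 2-cell. -/
  cell : u ≫ inl ⟶ v ≫ inr

/-- Pasting with a square under the span `(u, v)`: the functor from `K(pt, X)` to the comma
category of `K(u, X)` over `K(v, X)`. -/
def LaxSquare.paste {u : C ⟶ A} {v : C ⟶ B} (P : LaxSquare u v) (X : K) :
    (P.pt ⟶ X) ⥤ Comma (precomp X u) (precomp X v) where
  obj h :=
    { left := P.inl ≫ h
      right := P.inr ≫ h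
      hom := (α_ u P.inl h).inv ≫ P.cell ▷ h ≫ (α_ v P.inr h).hom }
  map θ :=
    { left := P.inl ◁ θ
      right := P.inr ◁ θ
      w := by
        change u ◁ P.inl ◁ θ ≫ (α_ u P.inl _).inv ≫ P.cell ▷ _ ≫ (α_ v P.inr _).hom =
          ((α_ u P.inl _).inv ≫ P.cell ▷ _ ≫ (α_ v P.inr _).hom) ≫ v ◁ P.inr ◁ θ
        rw [Category.assoc, Category.assoc, associator_inv_naturality_right_assoc, whisker_exchange_assoc,
          associator_naturality_right] }

/-- A coslice `u ↑ v` of the span `A ⟵ C ⟶ B`, that is, a slice (comma object) in `Kᵒᵖ`: a square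
such that pasting with it is an equivalence of categories
`K(u ↑ v, X) ≃ K(u, X) ↓ K(v, X)` for every `X`. -/
structure Coslice (u : C ⟶ A) (v : C ⟶ B) extends LaxSquare u v where
  isEquivalence : ∀ X : K, (toLaxSquare.paste X).IsEquivalence

/-- For `u : C ⟶ A`, the structure on `ubar : C ↑ u ⟶ A ↑ A` of being the canonical comparison
morphism: isomorphisms `ubar ∘ i_u ≅ i_A ∘ u` and `ubar ∘ j_u ≅ j_A` through which the 2-cell
`i_A ∘ u ⟶ j_A ∘ u` of `A ↑ A` is the 2-cell of `C ↑ u` followed by `ubar`. -/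
structure CofibComparison (u : C ⟶ A) (P : Coslice (𝟙 C) u) (Q : Coslice (𝟙 A) (𝟙 A)) where
  /-- The comparison morphism. -/
  ubar : P.pt ⟶ Q.pt
  /-- The first isomorphism. -/
  isoL : P.inl ≫ ubar ≅ u ≫ Q.inl
  /-- The second isomorphism. -/
  isoR : P.inr ≫ ubar ≅ Q.inr
  compat :
    P.cell ▷ ubar ≫ (α_ u P.inr ubar).hom ≫ u ◁ isoR.hom =
      (λ_ P.inl).hom ▷ ubar ≫ isoL.hom ≫
        u ◁ ((λ_ Q.inl).inv ≫ Q.cell ≫ (λ_ Q.inr).hom)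

/-- A cofibration: a fibration in `Kᵒᵖ`. The canonical `ubar : C ↑ u ⟶ A ↑ A` has a left adjoint
with invertible counit. (Coslices and `ubar` are unique up to equivalence, so any choice will
do.) -/
def IsCofibration (u : C ⟶ A) : Prop :=
  ∃ (P : Coslice (𝟙 C) u) (Q : Coslice (𝟙 A) (𝟙 A)) (c : CofibComparison u P Q)
    (l : Q.pt ⟶ P.pt) (adj : l ⊣ c.ubar), IsIso adj.counit

/-- The structure of `CofibComparison` with the 2-cells of `K` reversed: a coslice of a span
`(u, v)` in `Kᶜᵒ` is a coslice of `(v, u)` in `K` with its two coprojections exchanged. -/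
structure CoopfibComparison (u : C ⟶ A) (P : Coslice u (𝟙 C)) (Q : Coslice (𝟙 A) (𝟙 A)) where
  /-- The comparison morphism `u ↑ C ⟶ A ↑ A`. -/
  ubar : P.pt ⟶ Q.pt
  /-- The first isomorphism. -/
  isoL : P.inl ≫ ubar ≅ Q.inl
  /-- The second isomorphism. -/
  isoR : P.inr ≫ ubar ≅ u ≫ Q.inr
  compat :
    P.cell ▷ ubar ≫ (λ_ P.inr).hom ▷ ubar ≫ isoR.hom =
      (α_ u P.inl ubar).hom ≫ u ◁ isoL.hom ≫
        u ◁ ((λ_ Q.inl).inv ≫ Q.cell ≫ (λ_ Q.inr).hom)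

/-- A coopfibration: a fibration in `Kᶜᵒᵒᵖ`, that is, a cofibration in `Kᶜᵒ`. The canonical
`ubar : u ↑ C ⟶ A ↑ A` has a right adjoint with invertible unit. -/
def IsCoopfibration (u : C ⟶ A) : Prop :=
  ∃ (P : Coslice u (𝟙 C)) (Q : Coslice (𝟙 A) (𝟙 A)) (c : CoopfibComparison u P Q)
    (r : Q.pt ⟶ P.pt) (adj : c.ubar ⊣ r), IsIso adj.unit

/-- Two morphisms out of `A` are equivalent under `A`: there is an equivalence between their
codomains that carries the one to the other up to an invertible 2-cell. -/
def EquivalentUnder {X Y : K} (f : A ⟶ X) (g : A ⟶ Y) : Prop :=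
  ∃ e : X ≌ Y, Nonempty (f ≫ e.hom ≅ g)

end CategoryTheory.Bicategory

/-! ### Fully faithful `V`-functors, sieves and opsieves -/

namespace VCat

open MonoidalCategory

variable {V : Type v} [Category.{w} V] [MonoidalCategory V]

/-- A fully faithful `V`-functor: all its hom-maps are isomorphisms in `V`. -/
def FullyFaithful {A X : VCat.{w, v, u} V} (F : A ⟶ X) : Prop :=
  ∀ a b : A, IsIso (Fun.map F a b)

/-- The full sub-`V`-category of `X` on the set `S` of objects is a sieve: `X(x, a)` is initial
whenever `a ∈ S` and `x ∉ S`. -/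
def IsSieve {X : VCat.{w, v, u} V} (S : Set X) : Prop :=
  ∀ x ∉ S, ∀ a ∈ S, Nonempty (Limits.IsInitial (x ⟶[V] a))

/-- The full sub-`V`-category of `X` on the set `S` of objects is an opsieve: `X(a, x)` is initial
whenever `a ∈ S` and `x ∉ S`. -/
def IsOpsieve {X : VCat.{w, v, u} V} (S : Set X) : Prop :=
  ∀ x ∉ S, ∀ a ∈ S, Nonempty (Limits.IsInitial (a ⟶[V] x))

/-- `i : A ⟶ X` is (up to renaming objects of `A`) the inclusion of a full sub-`V`-category. -/
def IsFullInclusion {A X : VCat.{w, v, u} V} (i : A ⟶ X) : Prop :=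
  Function.Injective (Fun.obj i) ∧ FullyFaithful i

/-- `i : A ⟶ X` is the inclusion of a sieve. -/
def IsSieveInclusion {A X : VCat.{w, v, u} V} (i : A ⟶ X) : Prop :=
  IsFullInclusion i ∧ IsSieve (Set.range (Fun.obj i))

/-- `i : A ⟶ X` is the inclusion of an opsieve. -/
def IsOpsieveInclusion {A X : VCat.{w, v, u} V} (i : A ⟶ X) : Prop :=
  IsFullInclusion i ∧ IsOpsieve (Set.range (Fun.obj i))

end VCat

/-!
For `f : A ⟶ X` the coslice `A ↑ f` has an explicit model: the collage with objects `A ⊔ X`, in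
which the hom-object from `a` to `x` is `X(f a, x)` and the hom-object from `x` to `a` is `0`. The
same construction with `f` the identity gives `X ↑ X`, and with `X(x, f a)` from `x` to `a` it gives
`f ↑ A`. All three are collages of profunctors `(a, b) ↦ D(F a, G b)` with `F` or `G` an identity,
so they are treated together. Symmetry, closedness and the existence of an initial object enter
only here: tensoring preserves `0`, so the collage is a `V`-category. As a 2-cell
`h ⟶ k ∘ f` amounts, by Yoneda, to a compatible family `X(f a, x) ⟶ Z(h a, k x)`, the collage is a
coslice (`collage.cosliceLeft`, `collage.cosliceRight`). Coslices are unique up to equivalence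
(`Coslice.exists_equivalence`), so in any coslice `P` of `A ⟵ A ⟶ X` the coprojections are fully
faithful, the hom-objects `P(j x, i a)` are initial, each object is isomorphic to some `i a` or
`j x`, and `y ↦ P(i a, j y)` is corepresented by `f a` on underlying categories.

Let `l ⊣ ubar` have invertible counit, with `ubar : A ↑ f ⟶ X ↑ X`. Then `ubar` is fully faithful,
and as `ubar ∘ i ≅ i ∘ f` with both `i` fully faithful, so is `f`. For an object `x` of `X`, consider
the object `l (i x)` of `A ↑ f`.
* If it is isomorphic to `j y` for some `y`, then
  `X(x, f a) ≅ (X ↑ X)(i x, ubar (i a)) ≅ (A ↑ f)(j y, i a)`, which is initial for all `a`.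
* If it is isomorphic to `i a` for some `a`, then, naturally in `y` and on underlying categories,
  `X(x, y) ≅ (X ↑ X)(i x, j y) ≅ (A ↑ f)(i a, j y) ≅ X(f a, y)`, so that `x ≅ f a`.

Hence `X(x, f a)` is initial for all `a` whenever `x` is not in the essential image of `f`
(`exists_iso_or_isInitial_of_isCofibration`). Replacing the essential image of `f` by `A` itself
turns `X` into an equivalent `V`-category in which `A` is a sieve. Coopfibrations are dual.
-/

/-! ### Generalized elements of hom-objects and underlying categories -/

section

open MonoidalCategory

variable {V : Type v} [Category.{w} V] [MonoidalCategory V]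
  {C : Type*} [EnrichedCategory V C]

theorem elComp_assoc {a b c d : C} (f : 𝟙_ V ⟶ (a ⟶[V] b)) (g : 𝟙_ V ⟶ (b ⟶[V] c))
    (h : 𝟙_ V ⟶ (c ⟶[V] d)) : elComp (elComp f g) h = elComp f (elComp g h) := by
  rw [elComp_eq_post, elComp_eq_post, elComp_eq_post f, elPost_elComp, Category.assoc]

theorem elPre_eComp {a b : C} (f : 𝟙_ V ⟶ (a ⟶[V] b)) (y z : C) :
    elPre f y ▷ (y ⟶[V] z) ≫ eComp V a y z = eComp V b y z ≫ elPre f z := by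
  simp only [elPre, Category.assoc, MonoidalCategory.comp_whiskerRight]
  rw [leftUnitor_inv_naturality_assoc, MonoidalCategory.whisker_exchange_assoc, ← e_assoc]
  monoidal

theorem eComp_elPost {c d : C} (g : 𝟙_ V ⟶ (c ⟶[V] d)) (x y : C) :
    (x ⟶[V] y) ◁ elPost g y ≫ eComp V x y d = eComp V x y c ≫ elPost g x := by
  simp only [elPost, Category.assoc, MonoidalCategory.whiskerLeft_comp]
  rw [← e_assoc, rightUnitor_inv_naturality_assoc, ← MonoidalCategory.whisker_exchange_assoc]
  monoidal

/-- Composition is associative when the middle factor is an underlying morphism. -/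
theorem elPre_eComp_middle {a b : C} (f : 𝟙_ V ⟶ (a ⟶[V] b)) (x z : C) :
    (x ⟶[V] a) ◁ elPre f z ≫ eComp V x a z = elPost f x ▷ (b ⟶[V] z) ≫ eComp V x b z := by
  simp only [elPre, elPost, Category.assoc, MonoidalCategory.whiskerLeft_comp,
    MonoidalCategory.comp_whiskerRight]
  rw [← e_assoc]
  monoidal

end

namespace VCat

open MonoidalCategory Bicategory

variable {V : Type v} [Category.{w} V] [MonoidalCategory V]

section Und

/-- The underlying ordinary category of a `V`-category: a morphism `a ⟶ b` is a morphism
`𝟙_ V ⟶ A(a, b)` of `V`. It is a structure, and not a synonym of `A`, so that an object of `A` is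
never mistaken for an object of an ordinary category. -/
structure Und (A : VCat.{w, v, u} V) where
  /-- The object of `A`. -/
  of : A

variable {A B : VCat.{w, v, u} V}

instance : Category (Und A) where
  Hom a b := 𝟙_ V ⟶ (a.of ⟶[V] b.of)
  id a := eId V a.of
  comp f g := elComp f g
  id_comp f := eId_elComp f
  comp_id f := elComp_eId f
  assoc f g h := elComp_assoc f g h

/-- The functor between underlying categories given by a `V`-functor. -/
def Fun.und (F : A ⟶ B) : Und A ⥤ Und B where
  obj a := ⟨Fun.obj F a.of⟩
  -- Composition is in `V`, where `f` is a morphism out of the unit.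
  map {a b} f := CategoryStruct.comp (obj := V) f (Fun.map F a.of b.of)
  map_id a := F.toFun.map_id a.of
  map_comp f g := map_elComp F f g

/-- The natural transformation between underlying functors given by a `V`-natural
transformation. -/
def NatTrans.und {F G : A ⟶ B} (α : F ⟶ G) : Fun.und F ⟶ Fun.und G where
  app a := NatTrans.app α a.of
  naturality a b f := by
    change elComp (CategoryStruct.comp (obj := V) f (Fun.map F a.of b.of))
        (NatTrans.app α b.of) =
      elComp (NatTrans.app α a.of) (CategoryStruct.comp (obj := V) f (Fun.map G a.of b.of))
    rw [elComp_eq_post, elComp_eq_pre, Category.assoc, Category.assoc]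
    exact congrArg (CategoryStruct.comp (obj := V) f ·) (NatTrans.naturality α a.of b.of)

theorem NatTrans.und_comp {F G H : A ⟶ B} (α : F ⟶ G) (β : G ⟶ H) :
    NatTrans.und (α ≫ β) = NatTrans.und α ≫ NatTrans.und β := rfl

/-- The isomorphism between underlying functors given by an invertible `V`-natural
transformation. -/
def isoUnd {F G : A ⟶ B} (α : F ≅ G) : Fun.und F ≅ Fun.und G where
  hom := NatTrans.und α.hom
  inv := NatTrans.und α.inv
  hom_inv_id := by rw [← NatTrans.und_comp, α.hom_inv_id]; rfl
  inv_hom_id := by rw [← NatTrans.und_comp, α.inv_hom_id]; rfl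

/-- The component of an invertible `V`-natural transformation. -/
def isoApp {F G : A ⟶ B} (α : F ≅ G) (a : A) :
    (⟨Fun.obj F a⟩ : Und B) ≅ ⟨Fun.obj G a⟩ :=
  (isoUnd α).app ⟨a⟩

/-- Precomposition with an isomorphism of the underlying category. -/
def preIso {a b : A} (f : (⟨a⟩ : Und A) ≅ ⟨b⟩) (z : A) : (b ⟶[V] z) ≅ (a ⟶[V] z) where
  hom := elPre f.hom z
  inv := elPre f.inv z
  hom_inv_id := by
    rw [← elPre_elComp]; exact (congrArg (elPre · z) f.inv_hom_id).trans (elPre_id b z)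
  inv_hom_id := by
    rw [← elPre_elComp]; exact (congrArg (elPre · z) f.hom_inv_id).trans (elPre_id a z)

/-- Postcomposition with an isomorphism of the underlying category. -/
def postIso {a b : A} (f : (⟨a⟩ : Und A) ≅ ⟨b⟩) (z : A) : (z ⟶[V] a) ≅ (z ⟶[V] b) where
  hom := elPost f.hom z
  inv := elPost f.inv z
  hom_inv_id := by
    rw [← elPost_elComp]; exact (congrArg (elPost · z) f.hom_inv_id).trans (elPost_id a z)
  inv_hom_id := by
    rw [← elPost_elComp]; exact (congrArg (elPost · z) f.inv_hom_id).trans (elPost_id b z)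

/-- Hom-objects between isomorphic objects are isomorphic. -/
def homIso {a a' b b' : A} (f : (⟨a⟩ : Und A) ≅ ⟨a'⟩) (g : (⟨b⟩ : Und A) ≅ ⟨b'⟩) :
    (a ⟶[V] b) ≅ (a' ⟶[V] b') :=
  preIso f.symm b ≪≫ postIso g a'

/-- `NatTrans.naturality` for 1-cells and 2-cells of the bicategory. -/
theorem natTrans_naturality {F G : A ⟶ B} (α : F ⟶ G) (a b : A) :
    Fun.map F a b ≫ elPost (NatTrans.app α b) (Fun.obj F a) =
      Fun.map G a b ≫ elPre (NatTrans.app α a) (Fun.obj G b) :=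
  NatTrans.naturality α a b

/-- A `V`-natural transformation whose components are invertible is invertible. -/
noncomputable def isoOfComponents {F G : A ⟶ B} (α : F ⟶ G)
    (e : ∀ a, (⟨Fun.obj F a⟩ : Und B) ≅ ⟨Fun.obj G a⟩)
    (h : ∀ a, (e a).hom = NatTrans.app α a) : F ≅ G where
  hom := α
  inv :=
    { app := fun a => (e a).inv
      naturality := fun a b => by
        have hn := natTrans_naturality α a b
        rw [← h, ← h] at hn
        change Fun.map G a b ≫ (postIso (e b) _).inv = Fun.map F a b ≫ (preIso (e a) _).inv
        rw [Iso.comp_inv_eq, Category.assoc]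
        have hx := elPost_elPre (e a).inv (e b).hom
        change _ = Fun.map F a b ≫ elPre (e a).inv _ ≫ elPost (e b).hom _
        rw [← hx, reassoc_of% hn]
        exact ((Category.comp_id _).symm.trans
          (congrArg (Fun.map G a b ≫ ·) (preIso (e a) (Fun.obj G b)).hom_inv_id.symm)) }
  hom_inv_id := hom_ext fun a => by
    change elComp (NatTrans.app α a) (e a).inv = _
    rw [← h]; exact (e a).hom_inv_id
  inv_hom_id := hom_ext fun a => by
    change elComp (e a).inv (NatTrans.app α a) = _
    rw [← h]; exact (e a).inv_hom_id

end Und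

end VCat

/-! ### Adjunctions and fully faithful `V`-functors -/

namespace CategoryTheory.Bicategory

/-- The left triangle identity with its associator written out. -/
theorem Adjunction.left_triangle_associator {K : Type*} [Bicategory K] {a b : K} {f : a ⟶ b}
    {g : b ⟶ a} (adj : f ⊣ g) :
    adj.unit ▷ f ≫ (α_ f g f).hom ≫ f ◁ adj.counit = (λ_ f).hom ≫ (ρ_ f).inv := by
  rw [← adj.left_triangle]; bicategory

/-- The right triangle identity with its associator written out. -/
theorem Adjunction.right_triangle_associator {K : Type*} [Bicategory K] {a b : K} {f : a ⟶ b}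
    {g : b ⟶ a} (adj : f ⊣ g) :
    g ◁ adj.unit ≫ (α_ g f g).inv ≫ adj.counit ▷ g = (ρ_ g).hom ≫ (λ_ g).inv := by
  rw [← adj.right_triangle]; bicategory

end CategoryTheory.Bicategory

namespace VCat

open MonoidalCategory Bicategory

variable {V : Type v} [Category.{w} V] [MonoidalCategory V]

section Adjunction

variable {A B : VCat.{w, v, u} V} {F : A ⟶ B} {G : B ⟶ A}

/-- The component at `a` of the unit of an adjunction, as a morphism into `A(a, G (F a))`. -/
def adjUnit (adj : F ⊣ G) (a : A) : 𝟙_ V ⟶ (a ⟶[V] Fun.obj G (Fun.obj F a)) :=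
  NatTrans.app adj.unit a

/-- The component at `b` of the counit of an adjunction, as a morphism into `B(F (G b), b)`. -/
def adjCounit (adj : F ⊣ G) (b : B) : 𝟙_ V ⟶ (Fun.obj F (Fun.obj G b) ⟶[V] b) :=
  NatTrans.app adj.counit b

theorem adjUnit_naturality (adj : F ⊣ G) (a a' : A) :
    elPost (adjUnit adj a') a =
      Fun.map F a a' ≫ Fun.map G _ _ ≫ elPre (adjUnit adj a) _ :=
  (Category.id_comp _).symm.trans
    ((NatTrans.naturality adj.unit a a').trans (Category.assoc _ _ _))

theorem adjCounit_naturality (adj : F ⊣ G) (b b' : B) :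
    Fun.map G b b' ≫ Fun.map F _ _ ≫ elPost (adjCounit adj b') _ =
      elPre (adjCounit adj b) b' :=
  (Category.assoc _ _ _).symm.trans
    ((NatTrans.naturality adj.counit b b').trans (Category.id_comp _))

/-- The left triangle identity on components; the coherence 2-cells have identity components. -/
theorem adj_left_triangle (adj : F ⊣ G) (a : A) :
    elComp (adjUnit adj a ≫ Fun.map F _ _) (adjCounit adj (Fun.obj F a)) =
      eId V (Fun.obj F a) := by
  have h := adj.left_triangle_associator
  refine Eq.trans ?_ ((congrArg (fun α => NatTrans.app α a) h).trans (eId_elComp _))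
  exact congrArg (elComp _) (eId_elComp _).symm

/-- The right triangle identity on components; the coherence 2-cells have identity components. -/
theorem adj_right_triangle (adj : F ⊣ G) (b : B) :
    elComp (adjUnit adj (Fun.obj G b)) (adjCounit adj b ≫ Fun.map G _ _) =
      eId V (Fun.obj G b) := by
  have h := adj.right_triangle_associator
  refine Eq.trans ?_ ((congrArg (fun α => NatTrans.app α b) h).trans (eId_elComp _))
  exact congrArg (elComp _) (eId_elComp _).symm

/-- The isomorphism of hom-objects `B(F a, b) ≅ A(a, G b)` of an adjunction between
`V`-categories. -/
def adjHomIso (adj : F ⊣ G) (a : A) (b : B) :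
    (Fun.obj F a ⟶[V] b) ≅ (a ⟶[V] Fun.obj G b) where
  hom := Fun.map G _ _ ≫ elPre (adjUnit adj a) _
  inv := Fun.map F _ _ ≫ elPost (adjCounit adj b) _
  hom_inv_id := by
    have hp := elPre_map F.toFun (adjUnit adj a) (Fun.obj G b)
    rw [Category.assoc, reassoc_of% hp, ← elPost_elPre]
    have h := adjCounit_naturality adj (Fun.obj F a) b
    rw [reassoc_of% h, ← elPre_elComp, adj_left_triangle, elPre_id]
  inv_hom_id := by
    have hp := elPost_map G.toFun (adjCounit adj b) (Fun.obj F a)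
    rw [Category.assoc, reassoc_of% hp, elPost_elPre]
    have h := adjUnit_naturality adj a (Fun.obj G b)
    rw [← reassoc_of% h, ← elPost_elComp, adj_right_triangle, elPost_id]

/-- The adjunction between underlying categories. -/
def adjUnd (adj : F ⊣ G) : CategoryTheory.Adjunction (Fun.und F) (Fun.und G) :=
  CategoryTheory.Adjunction.mkOfUnitCounit
    { unit :=
        { app := fun a => adjUnit adj a.of
          naturality := fun _ _ f =>
            (congrArg (elComp · _) (Category.comp_id _)).symm.trans
              (((NatTrans.und adj.unit).naturality f).trans
                (congrArg (elComp _) (Category.assoc _ _ _).symm)) }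
      counit :=
        { app := fun b => adjCounit adj b.of
          naturality := fun _ _ f =>
            (congrArg (elComp · _) (Category.assoc _ _ _)).trans
              (((NatTrans.und adj.counit).naturality f).trans
                (congrArg (elComp _) (Category.comp_id _))) }
      left_triangle := by
        ext a
        refine Eq.trans ?_ (adj_left_triangle adj a.of)
        exact congrArg (elComp _) (eId_elComp _)
      right_triangle := by
        ext b
        refine Eq.trans ?_ (adj_right_triangle adj b.of)
        exact congrArg (elComp _) (eId_elComp _) }

/-- Composed with the inverse of `adjHomIso`, the hom-maps of `G` become precomposition with the
counit. -/
theorem fullyFaithful_of_isIso_counit (adj : F ⊣ G) [IsIso adj.counit] : FullyFaithful G := by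
  intro b b'
  have h : Fun.map G b b' ≫ (adjHomIso adj (Fun.obj G b) b').inv =
      elPre (adjCounit adj b) b' := adjCounit_naturality adj b b'
  have : IsIso (elPre (adjCounit adj b) b') :=
    (preIso (isoApp (asIso adj.counit) b) b').isIso_hom
  rw [← h] at this
  exact IsIso.of_isIso_comp_right _ (adjHomIso adj (Fun.obj G b) b').inv

/-- Composed with `adjHomIso`, the hom-maps of `F` become postcomposition with the unit. -/
theorem fullyFaithful_of_isIso_unit (adj : F ⊣ G) [IsIso adj.unit] : FullyFaithful F := by
  intro a a'
  have h : Fun.map F a a' ≫ (adjHomIso adj a (Fun.obj F a')).hom =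
      elPost (adjUnit adj a') a := (adjUnit_naturality adj a a').symm
  have : IsIso (elPost (adjUnit adj a') a) :=
    (postIso (isoApp (asIso adj.unit) a') a).isIso_hom
  rw [← h] at this
  exact IsIso.of_isIso_comp_right _ (adjHomIso adj a (Fun.obj F a')).hom

end Adjunction

section FullyFaithful

variable {A B C : VCat.{w, v, u} V}

theorem FullyFaithful.of_iso {F G : A ⟶ B} (α : F ≅ G) (hF : FullyFaithful F) :
    FullyFaithful G := by
  intro a b
  have := hF a b
  have h : Fun.map F a b ≫ (postIso (isoApp α b) _).hom =
      Fun.map G a b ≫ (preIso (isoApp α a) _).hom := natTrans_naturality α.hom a b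
  have : IsIso (Fun.map G a b ≫ (preIso (isoApp α a) (Fun.obj G b)).hom) := by
    rw [← h]; infer_instance
  exact IsIso.of_isIso_comp_right _ (preIso (isoApp α a) (Fun.obj G b)).hom

theorem FullyFaithful.comp {F : A ⟶ B} {G : B ⟶ C} (hF : FullyFaithful F)
    (hG : FullyFaithful G) : FullyFaithful (F ≫ G) := fun a b =>
  IsIso.comp_isIso' (hF a b) (hG (Fun.obj F a) (Fun.obj F b))

theorem FullyFaithful.of_comp {F : A ⟶ B} {G : B ⟶ C} (hG : FullyFaithful G)
    (h : FullyFaithful (F ≫ G)) : FullyFaithful F := fun a b =>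
  have := hG (Fun.obj F a) (Fun.obj F b)
  have : IsIso (Fun.map F a b ≫ Fun.map G (Fun.obj F a) (Fun.obj F b)) := h a b
  IsIso.of_isIso_comp_right _ (Fun.map G (Fun.obj F a) (Fun.obj F b))

theorem fullyFaithful_of_equivalence (e : A ≌ B) : FullyFaithful e.hom :=
  let adj : e.hom ⊣ e.inv :=
    ⟨e.unit.hom, e.counit.hom, e.left_triangle_hom, e.right_triangle_hom⟩
  have : IsIso adj.unit := e.unit.isIso_hom
  fullyFaithful_of_isIso_unit adj

/-- A fully faithful `V`-functor is fully faithful on underlying categories. -/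
noncomputable def FullyFaithful.und {F : A ⟶ B} (hF : FullyFaithful F) :
    (Fun.und F).FullyFaithful where
  preimage {a b} f :=
    CategoryStruct.comp (obj := V) f (@inv _ _ _ _ (Fun.map F a.of b.of) (hF a.of b.of))
  map_preimage {a b} f :=
    have := hF a.of b.of
    have h (f : 𝟙_ V ⟶ (Fun.obj F a.of ⟶[V] Fun.obj F b.of)) :
        (f ≫ inv (Fun.map F a.of b.of)) ≫ Fun.map F a.of b.of = f := by simp
    h f
  preimage_map {a b} f :=
    have := hF a.of b.of
    have h (f : 𝟙_ V ⟶ (a.of ⟶[V] b.of)) :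
        (f ≫ Fun.map F a.of b.of) ≫ inv (Fun.map F a.of b.of) = f := by simp
    h f

end FullyFaithful

end VCat

/-! ### Uniqueness of coslices in a bicategory -/

namespace CategoryTheory.Bicategory

universe w' v' u'

variable {K : Type u'} [Bicategory.{w', v'} K] {A B C : K} {u : C ⟶ A} {v : C ⟶ B}

/-- A lax square as an object of the comma category that it represents. -/
def LaxSquare.toComma (P : LaxSquare u v) : Comma (precomp P.pt u) (precomp P.pt v) where
  left := P.inl
  right := P.inr
  hom := P.cell

/-- The commutativity condition of a morphism from a pasting to `P'.toComma`. -/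
theorem LaxSquare.comma_w {P P' : LaxSquare u v} {s : P.pt ⟶ P'.pt}
    (e : (P.paste P'.pt).obj s ⟶ P'.toComma) :
    u ◁ e.left ≫ P'.cell = ((α_ u P.inl s).inv ≫ P.cell ▷ s ≫ (α_ v P.inr s).hom) ≫ v ◁ e.right :=
  e.w

/-- Pasting with `P` along the identity gives back `P`. -/
def LaxSquare.pasteId (P : LaxSquare u v) : (P.paste P.pt).obj (𝟙 P.pt) ≅ P.toComma :=
  Comma.isoMk (ρ_ P.inl) (ρ_ P.inr) (by
    change u ◁ (ρ_ P.inl).hom ≫ P.cell =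
      ((α_ u P.inl (𝟙 P.pt)).inv ≫ P.cell ▷ 𝟙 P.pt ≫ (α_ v P.inr (𝟙 P.pt)).hom) ≫
        v ◁ (ρ_ P.inr).hom
    simp)

/-- The commutativity condition behind `LaxSquare.pasteComp`. -/
theorem LaxSquare.pasteComp_w {P P' : LaxSquare u v} {s : P.pt ⟶ P'.pt} {l : P.inl ≫ s ⟶ P'.inl}
    {r : P.inr ≫ s ⟶ P'.inr}
    (w : u ◁ l ≫ P'.cell = ((α_ u P.inl s).inv ≫ P.cell ▷ s ≫ (α_ v P.inr s).hom) ≫ v ◁ r)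
    {X : K} (h : P'.pt ⟶ X) :
    u ◁ ((α_ P.inl s h).inv ≫ l ▷ h) ≫
        (α_ u P'.inl h).inv ≫ P'.cell ▷ h ≫ (α_ v P'.inr h).hom =
      ((α_ u P.inl (s ≫ h)).inv ≫ P.cell ▷ (s ≫ h) ≫ (α_ v P.inr (s ≫ h)).hom) ≫
        v ◁ ((α_ P.inr s h).inv ≫ r ▷ h) := by
  have w' := congrArg (· ▷ h) w
  simp only [comp_whiskerRight, Category.assoc] at w'
  simp only [whiskerLeft_comp, Category.assoc, associator_inv_naturality_middle_assoc]
  rw [reassoc_of% w']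
  simp

/-- If `P` pasted with `s` is `P'`, then `P` pasted with `s ≫ h` is `P'` pasted with `h`. -/
def LaxSquare.pasteComp {P P' : LaxSquare u v} {s : P.pt ⟶ P'.pt}
    (e : (P.paste P'.pt).obj s ≅ P'.toComma) {X : K} (h : P'.pt ⟶ X) :
    (P.paste X).obj (s ≫ h) ≅ (P'.paste X).obj h :=
  Comma.isoMk ((α_ P.inl s h).symm ≪≫ whiskerRightIso (Comma.leftIso e) h)
    ((α_ P.inr s h).symm ≪≫ whiskerRightIso (Comma.rightIso e) h)
    (LaxSquare.pasteComp_w (LaxSquare.comma_w e.hom) h)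

/-- Coslices of a span are unique up to an equivalence compatible with the coprojections. -/
theorem Coslice.exists_equivalence (P P' : Coslice u v) :
    ∃ e : P.pt ≌ P'.pt, Nonempty (P.inl ≫ e.hom ≅ P'.inl) ∧ Nonempty (P.inr ≫ e.hom ≅ P'.inr) := by
  have := P.isEquivalence
  have := P'.isEquivalence
  let e := (P.paste P'.pt).objObjPreimageIso P'.toComma
  let e' := (P'.paste P.pt).objObjPreimageIso P.toComma
  -- Both composites paste to the square they started from, as the identities do.
  let η := (P.paste P.pt).preimageIso (LaxSquare.pasteComp e _ ≪≫ e' ≪≫ P.pasteId.symm)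
  let θ := (P'.paste P'.pt).preimageIso (LaxSquare.pasteComp e' _ ≪≫ e ≪≫ P'.pasteId.symm)
  exact ⟨.mkOfAdjointifyCounit η.symm θ, ⟨Comma.leftIso e⟩, ⟨Comma.rightIso e⟩⟩

end CategoryTheory.Bicategory

/-! ### Collages of profunctors represented by a cospan -/

section Collage

open MonoidalCategory Limits

variable {V : Type v} [Category.{w} V] [MonoidalCategory V]

section

variable [BraidedCategory V] [MonoidalClosed V] [HasInitial V]

/-- In a closed monoidal category tensoring preserves initial objects. -/
noncomputable def tensorInitialIsInitial (X : V) : IsInitial (X ⊗ ⊥_ V) :=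
  haveI : PreservesColimitsOfSize.{0, 0} (tensorLeft X) :=
    (ihom.adjunction X).leftAdjoint_preservesColimits
  initialIsInitial.isInitialObj (tensorLeft X) _

/-- In a closed braided monoidal category tensoring preserves initial objects. -/
noncomputable def initialTensorIsInitial (X : V) : IsInitial ((⊥_ V) ⊗ X) :=
  (tensorInitialIsInitial X).ofIso (β_ X (⊥_ V))

variable {A B D : Type*} [EnrichedCategory V A] [EnrichedCategory V B] [EnrichedCategory V D]

/-- The hom-objects of the collage of the profunctor `(a, b) ↦ D(F a, G b)`. -/
noncomputable def collageHom (F : EnrichedFunctor V A D) (G : EnrichedFunctor V B D) :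
    A ⊕ B → A ⊕ B → V
  | .inl a, .inl a' => a ⟶[V] a'
  | .inl a, .inr b => F.obj a ⟶[V] G.obj b
  | .inr _, .inl _ => ⊥_ V
  | .inr b, .inr b' => b ⟶[V] b'

/-- The composition of the collage: `A` and `B` act on `D(F a, G b)` through `F` and `G`, and the
remaining cases have an initial source. -/
noncomputable def collageComp (F : EnrichedFunctor V A D) (G : EnrichedFunctor V B D) :
    ∀ x y z : A ⊕ B, collageHom F G x y ⊗ collageHom F G y z ⟶ collageHom F G x z
  | .inl a, .inl a', .inl a'' => eComp V a a' a''
  | .inl a, .inl a', .inr b => F.map a a' ▷ _ ≫ eComp V (F.obj a) (F.obj a') (G.obj b)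
  | .inl a, .inr b, .inr b' => _ ◁ G.map b b' ≫ eComp V (F.obj a) (G.obj b) (G.obj b')
  | .inr b, .inr b', .inr b'' => eComp V b b' b''
  | .inl _, .inr _, .inl _ => (tensorInitialIsInitial _).to _
  | .inr _, .inl _, _ => (initialTensorIsInitial _).to _
  | .inr _, .inr _, .inl _ => (tensorInitialIsInitial _).to _

/-- The identities of the collage. -/
noncomputable def collageId (F : EnrichedFunctor V A D) (G : EnrichedFunctor V B D) :
    ∀ x : A ⊕ B, 𝟙_ V ⟶ collageHom F G x x
  | .inl a => eId V a
  | .inr b => eId V b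

/-- The collage of the profunctor `(a, b) ↦ D(F a, G b)`: the disjoint union of `A` and `B` with
`D(F a, G b)` as the hom-object from `a` to `b`, and nothing from `b` to `a`. -/
noncomputable abbrev collageStr (F : EnrichedFunctor V A D) (G : EnrichedFunctor V B D) :
    EnrichedCategory V (A ⊕ B) where
  Hom := collageHom F G
  id := collageId F G
  comp := collageComp F G
  id_comp := by
    rintro (a | b) (a' | b')
    · exact e_id_comp V a a'
    · have h : (λ_ (F.obj a ⟶[V] G.obj b')).inv ≫ eId V a ▷ _ ≫
          F.map a a ▷ _ ≫ eComp V (F.obj a) (F.obj a) (G.obj b') = 𝟙 _ := by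
        rw [← comp_whiskerRight_assoc, F.map_id, e_id_comp]
      exact h
    · exact initialIsInitial.hom_ext _ _
    · exact e_id_comp V b b'
  comp_id := by
    rintro (a | b) (a' | b')
    · exact e_comp_id V a a'
    · have h : (ρ_ (F.obj a ⟶[V] G.obj b')).inv ≫ _ ◁ eId V b' ≫
          _ ◁ G.map b' b' ≫ eComp V (F.obj a) (G.obj b') (G.obj b') = 𝟙 _ := by
        rw [← whiskerLeft_comp_assoc, G.map_id, e_comp_id]
      exact h
    · exact initialIsInitial.hom_ext _ _
    · exact e_comp_id V b b'
  assoc := by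
    -- The source is initial as soon as one of the three factors is.
    have h₁ : ∀ X Y : V, IsInitial ((⊥_ V) ⊗ X ⊗ Y) := fun X Y => initialTensorIsInitial _
    have h₂ : ∀ X Y : V, IsInitial (X ⊗ (⊥_ V) ⊗ Y) := fun X Y =>
      (tensorInitialIsInitial X).ofIso
        (whiskerLeftIso X (initialIsInitial.uniqueUpToIso (initialTensorIsInitial Y)))
    have h₃ : ∀ X Y : V, IsInitial (X ⊗ Y ⊗ ⊥_ V) := fun X Y =>
      (tensorInitialIsInitial X).ofIso
        (whiskerLeftIso X (initialIsInitial.uniqueUpToIso (tensorInitialIsInitial Y)))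
    rintro (a | b) (a' | b') (a'' | b'') (a''' | b''')
    · exact e_assoc V a a' a'' a'''
    · have h : (α_ (a ⟶[V] a') (a' ⟶[V] a'') (F.obj a'' ⟶[V] G.obj b''')).inv ≫
          eComp V a a' a'' ▷ _ ≫ F.map a a'' ▷ _ ≫ eComp V (F.obj a) (F.obj a'') (G.obj b''') =
          _ ◁ (F.map a' a'' ▷ _ ≫ eComp V (F.obj a') (F.obj a'') (G.obj b''')) ≫
            F.map a a' ▷ _ ≫ eComp V (F.obj a) (F.obj a') (G.obj b''') := by
        rw [← comp_whiskerRight_assoc, F.map_comp, whiskerLeft_comp, Category.assoc,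
          whisker_exchange_assoc, ← e_assoc, MonoidalCategory.tensorHom_def']
        monoidal
      exact h
    · exact (h₃ _ _).hom_ext _ _
    · have h : (α_ (a ⟶[V] a') (F.obj a' ⟶[V] G.obj b'') (b'' ⟶[V] b''')).inv ≫
          (F.map a a' ▷ _ ≫ eComp V (F.obj a) (F.obj a') (G.obj b'')) ▷ _ ≫
            _ ◁ G.map b'' b''' ≫ eComp V (F.obj a) (G.obj b'') (G.obj b''') =
          _ ◁ (_ ◁ G.map b'' b''' ≫ eComp V (F.obj a') (G.obj b'') (G.obj b''')) ≫
            F.map a a' ▷ _ ≫ eComp V (F.obj a) (F.obj a') (G.obj b''') := by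
        rw [whiskerLeft_comp, Category.assoc, whisker_exchange_assoc, ← e_assoc,
          whisker_exchange_assoc, comp_whiskerRight_assoc, ← whisker_exchange_assoc]
        monoidal
      exact h
    · exact (h₂ _ _).hom_ext _ _
    · exact (h₂ _ _).hom_ext _ _
    · exact (h₃ _ _).hom_ext _ _
    · have h : (α_ (F.obj a ⟶[V] G.obj b') (b' ⟶[V] b'') (b'' ⟶[V] b''')).inv ≫
          (_ ◁ G.map b' b'' ≫ eComp V (F.obj a) (G.obj b') (G.obj b'')) ▷ _ ≫
            _ ◁ G.map b'' b''' ≫ eComp V (F.obj a) (G.obj b'') (G.obj b''') =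
          _ ◁ eComp V b' b'' b''' ≫
            _ ◁ G.map b' b''' ≫ eComp V (F.obj a) (G.obj b') (G.obj b''') := by
        rw [← whiskerLeft_comp_assoc, G.map_comp, comp_whiskerRight_assoc,
          ← whisker_exchange_assoc, MonoidalCategory.tensorHom_def]
        simp only [whiskerLeft_comp, Category.assoc]
        rw [← e_assoc]
        monoidal
      exact h
    · exact (h₁ _ _).hom_ext _ _
    · exact (h₁ _ _).hom_ext _ _
    · exact (h₁ _ _).hom_ext _ _
    · exact (h₁ _ _).hom_ext _ _
    · exact (h₂ _ _).hom_ext _ _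
    · exact (h₂ _ _).hom_ext _ _
    · exact (h₃ _ _).hom_ext _ _
    · exact e_assoc V b b' b'' b'''

variable {Z : Type*} [EnrichedCategory V Z]

/-- A `V`-functor out of the collage amounts to `V`-functors `H` and `K` on the two summands and
a family `D(F a, G b) ⟶ Z(H a, K b)` compatible with the actions of `A` and `B`. -/
noncomputable abbrev collageDesc {F : EnrichedFunctor V A D} {G : EnrichedFunctor V B D}
    (H : EnrichedFunctor V A Z) (K : EnrichedFunctor V B Z)
    (T : ∀ a b, (F.obj a ⟶[V] G.obj b) ⟶ (H.obj a ⟶[V] K.obj b))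
    (hl : ∀ a a' b, F.map a a' ▷ _ ≫ eComp V (F.obj a) (F.obj a') (G.obj b) ≫ T a b =
      (H.map a a' ⊗ₘ T a' b) ≫ eComp V (H.obj a) (H.obj a') (K.obj b))
    (hr : ∀ a b b', _ ◁ G.map b b' ≫ eComp V (F.obj a) (G.obj b) (G.obj b') ≫ T a b' =
      (T a b ⊗ₘ K.map b b') ≫ eComp V (H.obj a) (K.obj b) (K.obj b')) :
    @EnrichedFunctor V _ _ (A ⊕ B) (collageStr F G) Z _ :=
  letI := collageStr F G
  { obj := Sum.elim H.obj K.obj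
    map := fun
      | .inl a, .inl a' => H.map a a'
      | .inl a, .inr b => T a b
      | .inr _, .inl _ => initialIsInitial.to _
      | .inr b, .inr b' => K.map b b'
    map_id := by
      rintro (a | b)
      · exact H.map_id a
      · exact K.map_id b
    map_comp := by
      rintro (a | b) (a' | b') (a'' | b'')
      · exact H.map_comp a a' a''
      · exact (Category.assoc _ _ _).trans (hl a a' b'')
      · exact (tensorInitialIsInitial _).hom_ext _ _
      · exact (Category.assoc _ _ _).trans (hr a b' b'')
      · exact (initialTensorIsInitial _).hom_ext _ _
      · exact (initialTensorIsInitial _).hom_ext _ _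
      · exact (tensorInitialIsInitial _).hom_ext _ _
      · exact K.map_comp b b' b'' }

end

section

variable {C X Z : Type*} [EnrichedCategory V C] [EnrichedCategory V X] [EnrichedCategory V Z]

/-- For a 2-cell `γ : H ⟶ K ∘ U`, the family `X(U c, x) ⟶ Z(K (U c), K x) ⟶ Z(H c, K x)` is
compatible with the action of `C`. -/
theorem map_elPre_left_action {U : EnrichedFunctor V C X} {H : EnrichedFunctor V C Z}
    {K : EnrichedFunctor V X Z} {γ : ∀ c, 𝟙_ V ⟶ (H.obj c ⟶[V] K.obj (U.obj c))} {c c' : C}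
    (hγ : H.map c c' ≫ elPost (γ c') (H.obj c) =
      U.map c c' ≫ K.map _ _ ≫ elPre (γ c) (K.obj (U.obj c'))) (x : X) :
    U.map c c' ▷ _ ≫ eComp V (U.obj c) (U.obj c') x ≫ K.map _ _ ≫ elPre (γ c) (K.obj x) =
      (H.map c c' ⊗ₘ K.map _ _ ≫ elPre (γ c') (K.obj x)) ≫
        eComp V (H.obj c) (H.obj c') (K.obj x) := by
  have h := congrArg (· ▷ (U.obj c' ⟶[V] x)) hγ
  simp only [comp_whiskerRight] at h
  rw [K.map_comp_assoc, ← elPre_eComp]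
  simp only [MonoidalCategory.tensorHom_def, whiskerLeft_comp, Category.assoc]
  rw [whisker_exchange_assoc, ← reassoc_of% h, elPre_eComp_middle, whisker_exchange_assoc]

/-- The family `X(x₀, x) ⟶ Z(K x₀, K x) ⟶ Z(z, K x)` given by `γ : z ⟶ K x₀` is compatible with the
action of `X`. -/
theorem map_elPre_right_action {x₀ : X} {K : EnrichedFunctor V X Z} {z : Z}
    (γ : 𝟙_ V ⟶ (z ⟶[V] K.obj x₀)) (x x' : X) :
    eComp V x₀ x x' ≫ K.map _ _ ≫ elPre γ (K.obj x') =
      (K.map _ _ ≫ elPre γ (K.obj x) ⊗ₘ K.map x x') ≫ eComp V z (K.obj x) (K.obj x') := by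
  rw [K.map_comp_assoc, ← elPre_eComp]
  simp only [MonoidalCategory.tensorHom_def', comp_whiskerRight, Category.assoc]

/-- The family `X(x, x₀) ⟶ Z(H x, H x₀) ⟶ Z(H x, z)` given by `γ : H x₀ ⟶ z` is compatible with the
action of `X`. -/
theorem map_elPost_left_action {x₀ : X} {H : EnrichedFunctor V X Z} {z : Z}
    (γ : 𝟙_ V ⟶ (H.obj x₀ ⟶[V] z)) (x x' : X) :
    eComp V x x' x₀ ≫ H.map _ _ ≫ elPost γ (H.obj x) =
      (H.map x x' ⊗ₘ H.map _ _ ≫ elPost γ (H.obj x')) ≫ eComp V (H.obj x) (H.obj x') z := by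
  rw [H.map_comp_assoc, ← eComp_elPost]
  simp only [MonoidalCategory.tensorHom_def, whiskerLeft_comp, Category.assoc]

/-- For a 2-cell `γ : H ∘ U ⟶ K`, the family `X(x, U c) ⟶ Z(H x, H (U c)) ⟶ Z(H x, K c)` is
compatible with the action of `C`. -/
theorem map_elPost_right_action {U : EnrichedFunctor V C X} {H : EnrichedFunctor V X Z}
    {K : EnrichedFunctor V C Z} {γ : ∀ c, 𝟙_ V ⟶ (H.obj (U.obj c) ⟶[V] K.obj c)} {c c' : C}
    (hγ : U.map c c' ≫ H.map _ _ ≫ elPost (γ c') (H.obj (U.obj c)) =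
      K.map c c' ≫ elPre (γ c) (K.obj c')) (x : X) :
    _ ◁ U.map c c' ≫ eComp V x (U.obj c) (U.obj c') ≫ H.map _ _ ≫ elPost (γ c') (H.obj x) =
      (H.map _ _ ≫ elPost (γ c) (H.obj x) ⊗ₘ K.map c c') ≫
        eComp V (H.obj x) (K.obj c) (K.obj c') := by
  have h := congrArg ((x ⟶[V] U.obj c) ◁ ·) hγ
  simp only [whiskerLeft_comp] at h
  rw [H.map_comp_assoc, ← eComp_elPost]
  simp only [MonoidalCategory.tensorHom_def', comp_whiskerRight, Category.assoc]
  rw [← whisker_exchange_assoc, reassoc_of% h, ← elPre_eComp_middle, ← whisker_exchange_assoc]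

end

end Collage

/-! ### Squares with a collage as vertex -/

namespace VCat

open MonoidalCategory Bicategory Limits

variable {V : Type v} [Category.{w} V] [MonoidalCategory V]

section Naturality

variable {E Z : VCat.{w, v, u} V} {H K : E ⟶ Z}

/-- Naturality on `E(q, r)` and naturality on a morphism `γ : p ⟶ q` give naturality on the image
of `E(q, r)` in `E(p, r)`. -/
theorem naturality_of_elPre (app : ∀ x, 𝟙_ V ⟶ (Fun.obj H x ⟶[V] Fun.obj K x)) {p q r : E}
    (γ : 𝟙_ V ⟶ (p ⟶[V] q))
    (hγ : elComp (γ ≫ Fun.map H p q) (app q) = elComp (app p) (γ ≫ Fun.map K p q))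
    (h : Fun.map H q r ≫ elPost (app r) (Fun.obj H q) =
      Fun.map K q r ≫ elPre (app q) (Fun.obj K r)) :
    elPre γ r ≫ Fun.map H p r ≫ elPost (app r) (Fun.obj H p) =
      elPre γ r ≫ Fun.map K p r ≫ elPre (app p) (Fun.obj K r) := by
  have hH := elPre_map (Fun.toFun H) γ r
  have hK := elPre_map (Fun.toFun K) γ r
  rw [reassoc_of% hH, reassoc_of% hK, ← elPost_elPre, reassoc_of% h, ← elPre_elComp,
    ← elPre_elComp, hγ]

/-- Naturality on `E(r, p)` and naturality on a morphism `γ : p ⟶ q` give naturality on the image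
of `E(r, p)` in `E(r, q)`. -/
theorem naturality_of_elPost (app : ∀ x, 𝟙_ V ⟶ (Fun.obj H x ⟶[V] Fun.obj K x)) {p q r : E}
    (γ : 𝟙_ V ⟶ (p ⟶[V] q))
    (hγ : elComp (γ ≫ Fun.map H p q) (app q) = elComp (app p) (γ ≫ Fun.map K p q))
    (h : Fun.map H r p ≫ elPost (app p) (Fun.obj H r) =
      Fun.map K r p ≫ elPre (app r) (Fun.obj K p)) :
    elPost γ r ≫ Fun.map H r q ≫ elPost (app q) (Fun.obj H r) =
      elPost γ r ≫ Fun.map K r q ≫ elPre (app r) (Fun.obj K q) := by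
  have hH := elPost_map (Fun.toFun H) γ r
  have hK := elPost_map (Fun.toFun K) γ r
  rw [reassoc_of% hH, reassoc_of% hK, elPost_elPre, ← reassoc_of% h, ← elPost_elComp,
    ← elPost_elComp, hγ]

end Naturality

variable [BraidedCategory V] [MonoidalClosed V] [HasInitial V]
variable {A B C D : VCat.{w, v, u} V}

/-- The collage of the profunctor `(a, b) ↦ D(F a, G b)` from `A` to `B`. Its hom-objects reduce to
hom-objects of `A`, `B` and `D` only after unfolding, so equations about it are stated for those and
then transferred by definitional equality. -/
noncomputable def collage (F : A ⟶ D) (G : B ⟶ D) : VCat.{w, v, u} V where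
  carrier := A ⊕ B
  str := collageStr (Fun.toFun F) (Fun.toFun G)

section

variable (F : A ⟶ D) (G : B ⟶ D)

/-- The object of the collage given by an object of `A`. -/
def collage.l (a : A) : collage F G := Sum.inl a

/-- The object of the collage given by an object of `B`. -/
def collage.r (b : B) : collage F G := Sum.inr b

/-- The inclusion of `A` into the collage. -/
noncomputable def collage.inl : A ⟶ collage F G where
  toFun :=
    { obj := collage.l F G
      map := fun _ _ => 𝟙 _
      map_id := fun _ => Category.comp_id _
      map_comp := fun a a' a'' => (Category.comp_id (eComp V a a' a'')).trans
        ((Category.id_comp (eComp V a a' a'')).symm.trans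
          (congrArg (· ≫ eComp V a a' a'') (id_tensorHom_id _ _).symm)) }

/-- The inclusion of `B` into the collage. -/
noncomputable def collage.inr : B ⟶ collage F G where
  toFun :=
    { obj := collage.r F G
      map := fun _ _ => 𝟙 _
      map_id := fun _ => Category.comp_id _
      map_comp := fun b b' b'' => (Category.comp_id (eComp V b b' b'')).trans
        ((Category.id_comp (eComp V b b' b'')).symm.trans
          (congrArg (· ≫ eComp V b b' b'') (id_tensorHom_id _ _).symm)) }

end

variable {F : A ⟶ D} {G : B ⟶ D}

/-- Postcomposition in the collage with a morphism from `A` to `B`, in terms of `D`. -/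
theorem collage.elPost_l {a' : A} {b : B} (f : 𝟙_ V ⟶ (Fun.obj F a' ⟶[V] Fun.obj G b)) (a : A) :
    elPost (C := collage F G) (a := collage.l F G a') (b := collage.r F G b) f (collage.l F G a) =
      Fun.map F a a' ≫ elPost f (Fun.obj F a) := by
  have h : (ρ_ (a ⟶[V] a')).inv ≫ _ ◁ f ≫ Fun.map F a a' ▷ _ ≫
      eComp V (Fun.obj F a) (Fun.obj F a') (Fun.obj G b) =
      Fun.map F a a' ≫ elPost f (Fun.obj F a) := by
    rw [elPost, MonoidalCategory.whisker_exchange_assoc]; simp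
  exact h

/-- Precomposition in the collage with a morphism from `A` to `B`, in terms of `D`. -/
theorem collage.elPre_r {a : A} {b : B} (f : 𝟙_ V ⟶ (Fun.obj F a ⟶[V] Fun.obj G b)) (b' : B) :
    elPre (C := collage F G) (a := collage.l F G a) (b := collage.r F G b) f (collage.r F G b') =
      Fun.map G b b' ≫ elPre f (Fun.obj G b') := by
  have h : (λ_ (b ⟶[V] b')).inv ≫ f ▷ _ ≫ _ ◁ Fun.map G b b' ≫
      eComp V (Fun.obj F a) (Fun.obj G b) (Fun.obj G b') =
      Fun.map G b b' ≫ elPre f (Fun.obj G b') := by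
    rw [elPre, ← MonoidalCategory.whisker_exchange_assoc]; simp
  exact h

/-- The square under `(p, q)` with vertex a collage. -/
noncomputable abbrev collage.square {p : C ⟶ A} {q : C ⟶ B}
    (cell : p ≫ collage.inl F G ⟶ q ≫ collage.inr F G) : LaxSquare p q where
  pt := collage F G
  inl := collage.inl F G
  inr := collage.inr F G
  cell := cell

section Square

variable {p : C ⟶ A} {q : C ⟶ B} (cell : p ≫ collage.inl F G ⟶ q ≫ collage.inr F G)

/-- A `V`-natural transformation out of a collage is determined by its components, which are
those on `A` and those on `B`. -/
instance collage.faithful_paste (Z : VCat.{w, v, u} V) :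
    ((collage.square cell).paste Z).Faithful where
  map_injective {H K θ θ'} h := by
    apply hom_ext
    rintro (a | b)
    · exact congrArg (fun φ => NatTrans.app φ.left a) h
    · exact congrArg (fun φ => NatTrans.app φ.right b) h

/-- Pasting with a square on a collage is full as soon as naturality on the cross homs
`D(F a, G b)` follows from compatibility with the 2-cell of the square. -/
theorem collage.full_paste (Z : VCat.{w, v, u} V)
    (hc : ∀ (H K : collage F G ⟶ Z) (app : ∀ x, 𝟙_ V ⟶ (Fun.obj H x ⟶[V] Fun.obj K x)),
      (∀ a a', Fun.map H (collage.l F G a) (collage.l F G a') ≫ elPost (app _) _ =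
        Fun.map K _ _ ≫ elPre (app _) _) →
      (∀ b b', Fun.map H (collage.r F G b) (collage.r F G b') ≫ elPost (app _) _ =
        Fun.map K _ _ ≫ elPre (app _) _) →
      (∀ c, elComp (NatTrans.app cell c ≫ Fun.map H _ _) (app (collage.r F G (Fun.obj q c))) =
        elComp (app (collage.l F G (Fun.obj p c))) (NatTrans.app cell c ≫ Fun.map K _ _)) →
      ∀ a b, Fun.map H (collage.l F G a) (collage.r F G b) ≫ elPost (app _) _ =
        Fun.map K _ _ ≫ elPre (app _) _) :
    ((collage.square cell).paste Z).Full where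
  map_surjective {H K} φ := by
    let app : ∀ x : collage F G, 𝟙_ V ⟶ (Fun.obj H x ⟶[V] Fun.obj K x) := fun
      | .inl a => NatTrans.app φ.left a
      | .inr b => NatTrans.app φ.right b
    have hl : ∀ a a', Fun.map H (collage.l F G a) (collage.l F G a') ≫ elPost (app _) _ =
        Fun.map K _ _ ≫ elPre (app _) _ := fun a a' =>
      (congrArg (· ≫ _) (Category.id_comp _).symm).trans
        ((NatTrans.naturality φ.left a a').trans (congrArg (· ≫ _) (Category.id_comp _)))
    have hr : ∀ b b', Fun.map H (collage.r F G b) (collage.r F G b') ≫ elPost (app _) _ =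
        Fun.map K _ _ ≫ elPre (app _) _ := fun b b' =>
      (congrArg (· ≫ _) (Category.id_comp _).symm).trans
        ((NatTrans.naturality φ.right b b').trans (congrArg (· ≫ _) (Category.id_comp _)))
    have hw : ∀ c, elComp (NatTrans.app cell c ≫ Fun.map H _ _)
          (app (collage.r F G (Fun.obj q c))) =
        elComp (app (collage.l F G (Fun.obj p c))) (NatTrans.app cell c ≫ Fun.map K _ _) := by
      intro c
      have h := congrArg (fun α => NatTrans.app α c) φ.w
      refine Eq.trans ?_ (h.symm.trans ?_)
      · exact congrArg (elComp · _) ((eId_elComp _).trans (elComp_eId _)).symm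
      · exact congrArg (elComp _) ((eId_elComp _).trans (elComp_eId _))
    have hn := hc H K app hl hr hw
    refine ⟨{ app := app, naturality := ?_ }, rfl⟩
    rintro (a | b) (a' | b')
    · exact hl a a'
    · exact hn a b'
    · exact initialIsInitial.hom_ext _ _
    · exact hr b b'

/-- Pasting with a square on a collage is essentially surjective as soon as each 2-cell is induced
by a family of morphisms on the cross homs `D(F a, G b)` that is compatible with the actions of
`A` and `B`. -/
theorem collage.essSurj_paste (Z : VCat.{w, v, u} V)
    (hd : ∀ (H : A ⟶ Z) (K : B ⟶ Z) (γ : p ≫ H ⟶ q ≫ K),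
      ∃ T : ∀ a b, (Fun.obj F a ⟶[V] Fun.obj G b) ⟶ (Fun.obj H a ⟶[V] Fun.obj K b),
        (∀ a a' b, Fun.map F a a' ▷ _ ≫
            eComp V (Fun.obj F a) (Fun.obj F a') (Fun.obj G b) ≫ T a b =
          (Fun.map H a a' ⊗ₘ T a' b) ≫ eComp V (Fun.obj H a) (Fun.obj H a') (Fun.obj K b)) ∧
        (∀ a b b', _ ◁ Fun.map G b b' ≫
            eComp V (Fun.obj F a) (Fun.obj G b) (Fun.obj G b') ≫ T a b' =
          (T a b ⊗ₘ Fun.map K b b') ≫ eComp V (Fun.obj H a) (Fun.obj K b) (Fun.obj K b')) ∧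
        ∀ c, CategoryStruct.comp (obj := V) (NatTrans.app cell c)
          (T (Fun.obj p c) (Fun.obj q c)) = NatTrans.app γ c) :
    ((collage.square cell).paste Z).EssSurj where
  mem_essImage Y := by
    obtain ⟨T, hl, hr, hT⟩ := hd Y.left Y.right Y.hom
    let d : collage F G ⟶ Z := ⟨collageDesc (Fun.toFun Y.left) (Fun.toFun Y.right) T hl hr⟩
    let el : collage.inl F G ≫ d ≅ Y.left := isoOfComponents
      { app := fun a => eId V (Fun.obj Y.left a)
        naturality := fun a a' => by
          have h : (𝟙 _ ≫ Fun.map Y.left a a') ≫ elPost (eId V (Fun.obj Y.left a')) _ =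
            Fun.map Y.left a a' ≫ elPre (eId V (Fun.obj Y.left a)) _ := by
              rw [elPost_id, elPre_id, Category.id_comp]
          exact h }
      (fun a => Iso.refl _) (fun _ => rfl)
    let er : collage.inr F G ≫ d ≅ Y.right := isoOfComponents
      { app := fun a => eId V (Fun.obj Y.right a)
        naturality := fun a a' => by
          have h : (𝟙 _ ≫ Fun.map Y.right a a') ≫ elPost (eId V (Fun.obj Y.right a')) _ =
            Fun.map Y.right a a' ≫ elPre (eId V (Fun.obj Y.right a)) _ := by
              rw [elPost_id, elPre_id, Category.id_comp]
          exact h }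
      (fun a => Iso.refl _) (fun _ => rfl)
    refine ⟨d, ⟨Comma.isoMk el er ?_⟩⟩
    apply hom_ext
    intro c
    refine (eId_elComp _).trans ((hT c).symm.trans ?_)
    exact ((elComp_eId _).trans ((eId_elComp _).trans (elComp_eId _))).symm

end Square

end VCat

/-! ### Collages are coslices -/

namespace VCat

open MonoidalCategory Bicategory Limits

variable {V : Type v} [Category.{w} V] [MonoidalCategory V]
variable [BraidedCategory V] [MonoidalClosed V] [HasInitial V]
variable {C X : VCat.{w, v, u} V}

/-- The 2-cell of the collage of `(c, x) ↦ X(U c, x)`; its components are identities of `X`. -/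
noncomputable def collage.cellLeft (U : C ⟶ X) :
    𝟙 C ≫ collage.inl U (𝟙 X) ⟶ U ≫ collage.inr U (𝟙 X) where
  app c := eId V (Fun.obj U c)
  naturality c c' := by
    have hl := collage.elPost_l (F := U) (G := 𝟙 X) (a' := c') (b := Fun.obj U c')
      (eId V (Fun.obj U c')) c
    have hr := collage.elPre_r (F := U) (G := 𝟙 X) (a := c) (b := Fun.obj U c)
      (eId V (Fun.obj U c)) (Fun.obj U c')
    have h₁ := elPost_id (V := V) (Fun.obj U c') (Fun.obj U c)
    have h₂ := elPre_id (V := V) (Fun.obj U c) (Fun.obj U c')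
    refine (congrArg (_ ≫ ·) (hl.trans (congrArg (Fun.map U c c' ≫ ·) h₁))).trans
      (Eq.trans ?_ (congrArg (_ ≫ ·) (hr.trans (congrArg (𝟙 _ ≫ ·) h₂))).symm)
    have h : (𝟙 _ ≫ 𝟙 _) ≫ Fun.map U c c' ≫ 𝟙 _ = (Fun.map U c c' ≫ 𝟙 _) ≫ 𝟙 _ ≫ 𝟙 _ := by
      simp
    exact h

/-- The collage of `(c, x) ↦ X(U c, x)` is the coslice of `C ⟵ C ⟶ X`. -/
noncomputable def collage.cosliceLeft (U : C ⟶ X) : Coslice (𝟙 C) U where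
  toLaxSquare := collage.square (collage.cellLeft U)
  isEquivalence Z :=
    { -- Each morphism of `X(U c, x)` factors in the collage through the component `U c ⟶ U c` of
      -- the 2-cell.
      full := collage.full_paste _ Z fun H K app hl hr hw c x => by
        have h := naturality_of_elPre app (p := collage.l U (𝟙 X) c)
          (q := collage.r U (𝟙 X) (Fun.obj U c)) (r := collage.r U (𝟙 X) x)
          (eId V (Fun.obj U c)) (hw c) (hr _ _)
        have e := (collage.elPre_r (F := U) (G := 𝟙 X) (a := c) (eId V (Fun.obj U c)) x).trans
          ((Category.id_comp _).trans (elPre_id _ _))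
        rw [e] at h
        exact (Category.id_comp _).symm.trans (h.trans (Category.id_comp _))
      essSurj := collage.essSurj_paste _ Z fun H K γ =>
        ⟨fun c x => Fun.map K (Fun.obj U c) x ≫ elPre (NatTrans.app γ c) (Fun.obj K x),
          fun c c' x => map_elPre_left_action (U := Fun.toFun U) (H := Fun.toFun H)
            (K := Fun.toFun K) (γ := fun c => NatTrans.app γ c)
            ((congrArg (· ≫ _) (Category.id_comp _).symm).trans
              ((NatTrans.naturality γ c c').trans (Category.assoc _ _ _))) x,
          fun c x x' => (congrArg (· ≫ _) (MonoidalCategory.whiskerLeft_id _ _)).trans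
            ((Category.id_comp _).trans (map_elPre_right_action (K := Fun.toFun K)
              (NatTrans.app γ c) x x')),
          fun c => (Category.assoc _ _ _).symm.trans
            ((congrArg (· ≫ _) ((Fun.toFun K).map_id _)).trans
              ((elComp_eq_pre _ _).symm.trans (elComp_eId _)))⟩ }

/-- The 2-cell of the collage of `(x, c) ↦ X(x, U c)`; its components are identities of `X`. -/
noncomputable def collage.cellRight (U : C ⟶ X) :
    U ≫ collage.inl (𝟙 X) U ⟶ 𝟙 C ≫ collage.inr (𝟙 X) U where
  app c := eId V (Fun.obj U c)
  naturality c c' := by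
    have hl := collage.elPost_l (F := 𝟙 X) (G := U) (a' := Fun.obj U c') (b := c')
      (eId V (Fun.obj U c')) (Fun.obj U c)
    have hr := collage.elPre_r (F := 𝟙 X) (G := U) (a := Fun.obj U c) (b := c)
      (eId V (Fun.obj U c)) c'
    have h₁ := elPost_id (V := V) (Fun.obj U c') (Fun.obj U c)
    have h₂ := elPre_id (V := V) (Fun.obj U c) (Fun.obj U c')
    refine (congrArg (_ ≫ ·) (hl.trans (congrArg (𝟙 _ ≫ ·) h₁))).trans
      (Eq.trans ?_ (congrArg (_ ≫ ·) (hr.trans (congrArg (Fun.map U c c' ≫ ·) h₂))).symm)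
    have h : (Fun.map U c c' ≫ 𝟙 _) ≫ 𝟙 _ ≫ 𝟙 _ = (𝟙 _ ≫ 𝟙 _) ≫ Fun.map U c c' ≫ 𝟙 _ := by
      simp
    exact h

/-- The collage of `(x, c) ↦ X(x, U c)` is the coslice of `X ⟵ C ⟶ C`. -/
noncomputable def collage.cosliceRight (U : C ⟶ X) : Coslice U (𝟙 C) where
  toLaxSquare := collage.square (collage.cellRight U)
  isEquivalence Z :=
    { -- Each morphism of `X(x, U c)` factors in the collage through the component `U c ⟶ U c` of
      -- the 2-cell.
      full := collage.full_paste _ Z fun H K app hl hr hw x c => by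
        have h := naturality_of_elPost app (p := collage.l (𝟙 X) U (Fun.obj U c))
          (q := collage.r (𝟙 X) U c) (r := collage.l (𝟙 X) U x)
          (eId V (Fun.obj U c)) (hw c) (hl _ _)
        have e := (collage.elPost_l (F := 𝟙 X) (G := U) (b := c) (eId V (Fun.obj U c)) x).trans
          ((Category.id_comp _).trans (elPost_id _ _))
        rw [e] at h
        exact (Category.id_comp _).symm.trans (h.trans (Category.id_comp _))
      essSurj := collage.essSurj_paste _ Z fun H K γ =>
        ⟨fun x c => Fun.map H x (Fun.obj U c) ≫ elPost (NatTrans.app γ c) (Fun.obj H x),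
          fun x x' c => (congrArg (· ≫ _) (MonoidalCategory.id_whiskerRight _ _)).trans
            ((Category.id_comp _).trans (map_elPost_left_action (H := Fun.toFun H)
              (NatTrans.app γ c) x x')),
          fun x c c' => map_elPost_right_action (U := Fun.toFun U) (H := Fun.toFun H)
            (K := Fun.toFun K) (γ := fun c => NatTrans.app γ c)
            ((Category.assoc _ _ _).symm.trans
              ((NatTrans.naturality γ c c').trans (congrArg (· ≫ _) (Category.id_comp _)))) x,
          fun c => (Category.assoc _ _ _).symm.trans
            ((congrArg (· ≫ _) ((Fun.toFun H).map_id _)).trans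
              ((elComp_eq_post _ _).symm.trans (eId_elComp _)))⟩ }

end VCat

/-! ### Hom-objects of a coslice -/

section Representable

open Opposite

variable {X E P Q : Type*} [Category.{w} X] [Category.{w} E] [Category.{w} P] [Category.{w} Q]

/-- Corepresentability of `y ↦ E(l, R y)` is transported along a fully faithful functor. -/
def CategoryTheory.Functor.CorepresentableBy.transport {R : X ⥤ E} {S : E ⥤ P} {R' : X ⥤ P}
    (hS : S.FullyFaithful) (i : R ⋙ S ≅ R') {l : E} {l' : P} (j : S.obj l ≅ l') {x : X}
    (h : (R ⋙ coyoneda.obj (op l)).CorepresentableBy x) :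
    (R' ⋙ coyoneda.obj (op l')).CorepresentableBy x where
  homEquiv {y} := h.homEquiv.trans (hS.homEquiv.trans (j.homCongr (i.app y)))
  homEquiv_comp g f := by
    have hn := i.hom.naturality g
    dsimp at hn
    simp [h.homEquiv_comp, hn]

/-- Representability of `y ↦ E(R y, r)` is transported along a fully faithful functor. -/
def CategoryTheory.Functor.RepresentableBy.transport {R : X ⥤ E} {S : E ⥤ P} {R' : X ⥤ P}
    (hS : S.FullyFaithful) (i : R ⋙ S ≅ R') {r : E} {r' : P} (j : S.obj r ≅ r') {x : X}
    (h : (R.op ⋙ yoneda.obj r).RepresentableBy x) :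
    (R'.op ⋙ yoneda.obj r').RepresentableBy x where
  homEquiv {y} := h.homEquiv.trans (hS.homEquiv.trans ((i.app y).homCongr j))
  homEquiv_comp f g := by
    have hn := i.inv.naturality f
    dsimp at hn
    simp [h.homEquiv_comp, reassoc_of% hn]

/-- Corepresentability of `y ↦ Q(q, T y)` passes to the left adjoint when `T` factors through the
right adjoint. -/
def CategoryTheory.Functor.CorepresentableBy.leftAdjoint {L : Q ⥤ P} {R : P ⥤ Q} (adj : L ⊣ R)
    {S : X ⥤ P} {T : X ⥤ Q} (i : S ⋙ R ≅ T) {q : Q} {p : P} (j : L.obj q ≅ p) {x : X}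
    (h : (T ⋙ coyoneda.obj (op q)).CorepresentableBy x) :
    (S ⋙ coyoneda.obj (op p)).CorepresentableBy x where
  homEquiv {y} := h.homEquiv.trans (((Iso.refl q).homCongr (i.app y).symm).trans
    ((adj.homEquiv q (S.obj y)).symm.trans (j.homCongr (Iso.refl _))))
  homEquiv_comp g f := by
    have hn := i.inv.naturality g
    dsimp at hn
    simp [h.homEquiv_comp, hn, ← Adjunction.homEquiv_naturality_right_symm]

/-- Representability of `y ↦ Q(T y, q)` passes to the right adjoint when `T` factors through the
left adjoint. -/
def CategoryTheory.Functor.RepresentableBy.rightAdjoint {L : P ⥤ Q} {R : Q ⥤ P} (adj : L ⊣ R)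
    {S : X ⥤ P} {T : X ⥤ Q} (i : S ⋙ L ≅ T) {q : Q} {p : P} (j : R.obj q ≅ p) {x : X}
    (h : (T.op ⋙ yoneda.obj q).RepresentableBy x) :
    (S.op ⋙ yoneda.obj p).RepresentableBy x where
  homEquiv {y} := h.homEquiv.trans (((i.app y).symm.homCongr (Iso.refl q)).trans
    ((adj.homEquiv (S.obj y) q).trans ((Iso.refl _).homCongr j)))
  homEquiv_comp f g := by
    have hn := i.hom.naturality f
    dsimp at hn
    have ha := adj.homEquiv_naturality_left (S.map f) (i.hom.app _ ≫ h.homEquiv g)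
    simp [h.homEquiv_comp, ← reassoc_of% ha, reassoc_of% hn]

end Representable

namespace VCat

open MonoidalCategory Bicategory Limits Opposite

variable {V : Type v} [Category.{w} V] [MonoidalCategory V]

/-- Passage to underlying functors preserves composition. -/
def undComp {A B C : VCat.{w, v, u} V} (F : A ⟶ B) (G : B ⟶ C) :
    Fun.und F ⋙ Fun.und G ≅ Fun.und (F ≫ G) :=
  NatIso.ofComponents (fun _ => Iso.refl _) (fun _ =>
    ((elComp_eId _).trans (Category.assoc _ _ _)).trans (eId_elComp _).symm)

variable [BraidedCategory V] [MonoidalClosed V] [HasInitial V]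

section Collage

variable {A B D P : VCat.{w, v, u} V} {F : A ⟶ D} {G : B ⟶ D}

theorem collage.fullyFaithful_inl : FullyFaithful (collage.inl F G) := fun _ _ =>
  inferInstanceAs (IsIso (𝟙 _))

theorem collage.fullyFaithful_inr : FullyFaithful (collage.inr F G) := fun _ _ =>
  inferInstanceAs (IsIso (𝟙 _))

/-- Up to equivalence, there is nothing from `B` to `A` in a collage. -/
theorem collage.isInitial_hom (e : collage F G ≌ P) {inl : A ⟶ P} {inr : B ⟶ P}
    (iL : collage.inl F G ≫ e.hom ≅ inl) (iR : collage.inr F G ≫ e.hom ≅ inr) (a : A) (b : B) :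
    Nonempty (IsInitial (Fun.obj inr b ⟶[V] Fun.obj inl a)) := by
  have := fullyFaithful_of_equivalence e (collage.r F G b) (collage.l F G a)
  exact ⟨(show IsInitial (collage.r F G b ⟶[V] collage.l F G a) from initialIsInitial).ofIso
    (@asIso _ _ _ _ (Fun.map e.hom (collage.r F G b) (collage.l F G a)) this ≪≫
      homIso (isoApp iR b) (isoApp iL a))⟩

/-- Up to equivalence, each object of a collage comes from `A` or from `B`. -/
theorem collage.exists_iso (e : collage F G ≌ P) {inl : A ⟶ P} {inr : B ⟶ P}
    (iL : collage.inl F G ≫ e.hom ≅ inl) (iR : collage.inr F G ≫ e.hom ≅ inr) (p : P) :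
    (∃ a, Nonempty ((⟨p⟩ : Und P) ≅ ⟨Fun.obj inl a⟩)) ∨
      ∃ b, Nonempty ((⟨p⟩ : Und P) ≅ ⟨Fun.obj inr b⟩) := by
  have i : (⟨p⟩ : Und P) ≅ ⟨Fun.obj e.hom (Fun.obj e.inv p)⟩ := (isoApp e.counit p).symm
  generalize Fun.obj e.inv p = x at i
  obtain a | b := x
  · exact .inl ⟨a, ⟨i ≪≫ isoApp iL a⟩⟩
  · exact .inr ⟨b, ⟨i ≪≫ isoApp iR b⟩⟩

/-- The composite of `f : l a ⟶ r x` with `r g` in the collage of `(a, x) ↦ D(U a, x)` is the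
composite of `f` and `g` in `D`. -/
theorem collage.elComp_map_inr {U : A ⟶ D} {a : A} {x x' : D}
    (f : 𝟙_ V ⟶ (Fun.obj U a ⟶[V] x)) (g : 𝟙_ V ⟶ (x ⟶[V] x')) :
    elComp f g = elComp (C := collage U (𝟙 D)) (a := collage.l U (𝟙 D) a)
      (b := collage.r U (𝟙 D) x) f (g ≫ Fun.map (collage.inr U (𝟙 D)) x x') := by
  have hr := collage.elPre_r (F := U) (G := 𝟙 D) (a := a) (b := x) f x'
  have h := elComp_eq_pre (C := collage U (𝟙 D)) (a := collage.l U (𝟙 D) a)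
    (b := collage.r U (𝟙 D) x) (c := collage.r U (𝟙 D) x') f
    (CategoryStruct.comp (obj := V) g (Fun.map (collage.inr U (𝟙 D)) x x'))
  refine (elComp_eq_pre f g).trans (Eq.trans ?_ h.symm)
  exact congrArg₂ (CategoryStruct.comp (obj := V)) (Category.comp_id g).symm
    (hr.trans (Category.id_comp _)).symm

/-- The composite of `l f` with `g : l x' ⟶ r a` in the collage of `(x, a) ↦ D(x, U a)` is the
composite of `f` and `g` in `D`. -/
theorem collage.map_inl_elComp {U : A ⟶ D} {a : A} {x x' : D}
    (f : 𝟙_ V ⟶ (x ⟶[V] x')) (g : 𝟙_ V ⟶ (x' ⟶[V] Fun.obj U a)) :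
    elComp f g = elComp (C := collage (𝟙 D) U) (b := collage.l (𝟙 D) U x')
      (c := collage.r (𝟙 D) U a) (f ≫ Fun.map (collage.inl (𝟙 D) U) x x') g := by
  have hl := collage.elPost_l (F := 𝟙 D) (G := U) (a' := x') (b := a) g x
  have h := elComp_eq_post (C := collage (𝟙 D) U) (a := collage.l (𝟙 D) U x)
    (b := collage.l (𝟙 D) U x') (c := collage.r (𝟙 D) U a)
    (CategoryStruct.comp (obj := V) f (Fun.map (collage.inl (𝟙 D) U) x x')) g
  refine (elComp_eq_post f g).trans (Eq.trans ?_ h.symm)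
  exact congrArg₂ (CategoryStruct.comp (obj := V)) (Category.comp_id f).symm
    (hl.trans (Category.id_comp _)).symm

end Collage

section Coslice

variable {C X : VCat.{w, v, u} V} {U : C ⟶ X}

theorem cosliceLeft_fullyFaithful_inl (P : Coslice (𝟙 C) U) : FullyFaithful P.inl := by
  obtain ⟨e, ⟨iL⟩, -⟩ := (collage.cosliceLeft U).exists_equivalence P
  exact .of_iso iL (collage.fullyFaithful_inl.comp (fullyFaithful_of_equivalence e))

theorem cosliceLeft_isInitial (P : Coslice (𝟙 C) U) (c : C) (x : X) :
    Nonempty (IsInitial (Fun.obj P.inr x ⟶[V] Fun.obj P.inl c)) := by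
  obtain ⟨e, ⟨iL⟩, ⟨iR⟩⟩ := (collage.cosliceLeft U).exists_equivalence P
  exact collage.isInitial_hom e iL iR c x

theorem cosliceLeft_exists_iso (P : Coslice (𝟙 C) U) (p : P.pt) :
    (∃ c, Nonempty ((⟨p⟩ : Und P.pt) ≅ ⟨Fun.obj P.inl c⟩)) ∨
      ∃ x, Nonempty ((⟨p⟩ : Und P.pt) ≅ ⟨Fun.obj P.inr x⟩) := by
  obtain ⟨e, ⟨iL⟩, ⟨iR⟩⟩ := (collage.cosliceLeft U).exists_equivalence P
  exact collage.exists_iso e iL iR p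

/-- On underlying categories, `(C ↑ U)(inl c, inr x) ≅ X(U c, x)` naturally in `x`. -/
theorem cosliceLeft_corepresentableBy (P : Coslice (𝟙 C) U) (c : C) :
    Nonempty ((Fun.und P.inr ⋙ coyoneda.obj (op ⟨Fun.obj P.inl c⟩)).CorepresentableBy
      (⟨Fun.obj U c⟩ : Und X)) := by
  obtain ⟨e, ⟨iL⟩, ⟨iR⟩⟩ := (collage.cosliceLeft U).exists_equivalence P
  have h : (Fun.und (collage.inr U (𝟙 X)) ⋙
      coyoneda.obj (op ⟨collage.l U (𝟙 X) c⟩)).CorepresentableBy (⟨Fun.obj U c⟩ : Und X) :=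
    { homEquiv := Equiv.refl _
      homEquiv_comp := fun {x x'} g f => by
        exact collage.elComp_map_inr f g }
  exact ⟨h.transport (fullyFaithful_of_equivalence e).und (undComp _ _ ≪≫ isoUnd iR)
    (isoApp iL c)⟩

theorem cosliceRight_fullyFaithful_inr (P : Coslice U (𝟙 C)) : FullyFaithful P.inr := by
  obtain ⟨e, -, ⟨iR⟩⟩ := (collage.cosliceRight U).exists_equivalence P
  exact .of_iso iR (collage.fullyFaithful_inr.comp (fullyFaithful_of_equivalence e))

theorem cosliceRight_isInitial (P : Coslice U (𝟙 C)) (x : X) (c : C) :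
    Nonempty (IsInitial (Fun.obj P.inr c ⟶[V] Fun.obj P.inl x)) := by
  obtain ⟨e, ⟨iL⟩, ⟨iR⟩⟩ := (collage.cosliceRight U).exists_equivalence P
  exact collage.isInitial_hom e iL iR x c

theorem cosliceRight_exists_iso (P : Coslice U (𝟙 C)) (p : P.pt) :
    (∃ x, Nonempty ((⟨p⟩ : Und P.pt) ≅ ⟨Fun.obj P.inl x⟩)) ∨
      ∃ c, Nonempty ((⟨p⟩ : Und P.pt) ≅ ⟨Fun.obj P.inr c⟩) := by
  obtain ⟨e, ⟨iL⟩, ⟨iR⟩⟩ := (collage.cosliceRight U).exists_equivalence P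
  exact collage.exists_iso e iL iR p

/-- On underlying categories, `(U ↑ C)(inl x, inr c) ≅ X(x, U c)` naturally in `x`. -/
theorem cosliceRight_representableBy (P : Coslice U (𝟙 C)) (c : C) :
    Nonempty (((Fun.und P.inl).op ⋙ yoneda.obj ⟨Fun.obj P.inr c⟩).RepresentableBy
      (⟨Fun.obj U c⟩ : Und X)) := by
  obtain ⟨e, ⟨iL⟩, ⟨iR⟩⟩ := (collage.cosliceRight U).exists_equivalence P
  have h : ((Fun.und (collage.inl (𝟙 X) U)).op ⋙
      yoneda.obj ⟨collage.r (𝟙 X) U c⟩).RepresentableBy (⟨Fun.obj U c⟩ : Und X) :=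
    { homEquiv := Equiv.refl _
      homEquiv_comp := fun {x x'} f g => by
        exact collage.map_inl_elComp f g }
  exact ⟨h.transport (fullyFaithful_of_equivalence e).und (undComp _ _ ≪≫ isoUnd iL)
    (isoApp iR c)⟩

end Coslice

end VCat

/-! ### Replacing an essential image -/

namespace VCat

open MonoidalCategory Bicategory

variable {V : Type v} [Category.{w} V] [MonoidalCategory V] {A X : VCat.{w, v, u} V}

/-- The `V`-category with set of objects `T` and the hom-objects of `X` between images under
`g : T → X`. -/
def full {T : Type u} (g : T → X) : VCat.{w, v, u} V where
  carrier := T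
  str :=
    { Hom := fun s t => g s ⟶[V] g t
      id := fun t => eId V (g t)
      comp := fun r s t => eComp V (g r) (g s) (g t)
      id_comp := fun s t => e_id_comp V (g s) (g t)
      comp_id := fun s t => e_comp_id V (g s) (g t)
      assoc := fun q r s t => e_assoc V (g q) (g r) (g s) (g t) }

section Full

variable {T : Type u} (g : T → X)

/-- The fully faithful `V`-functor `full g ⟶ X` that is `g` on objects. -/
def fullι : full g ⟶ X where
  toFun :=
    { obj := g
      map := fun _ _ => 𝟙 _
      map_id := fun _ => Category.comp_id _
      map_comp := fun r s t => (Category.comp_id (eComp V (g r) (g s) (g t))).trans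
        ((Category.id_comp (eComp V (g r) (g s) (g t))).symm.trans
          (congrArg (· ≫ eComp V (g r) (g s) (g t)) (id_tensorHom_id _ _).symm)) }

variable {g}

/-- Conjugation by isomorphisms is compatible with composition. -/
theorem homIso_comp {x x' y y' z z' : X} (i : (⟨x⟩ : Und X) ≅ ⟨x'⟩) (j : (⟨y⟩ : Und X) ≅ ⟨y'⟩)
    (k : (⟨z⟩ : Und X) ≅ ⟨z'⟩) :
    eComp V x y z ≫ (homIso i k).hom =
      ((homIso i j).hom ⊗ₘ (homIso j k).hom) ≫ eComp V x' y' z' := by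
  have h := congrArg (MonoidalCategoryStruct.whiskerRight · (y ⟶[V] z)) (postIso j x').hom_inv_id
  simp only [MonoidalCategory.comp_whiskerRight, MonoidalCategory.id_whiskerRight] at h
  change elPost j.hom x' ▷ (y ⟶[V] z) ≫ elPost j.inv x' ▷ (y ⟶[V] z) = 𝟙 _ at h
  change eComp V x y z ≫ elPre i.inv z ≫ elPost k.hom x' =
    ((elPre i.inv y ≫ elPost j.hom x') ⊗ₘ (elPre j.inv z ≫ elPost k.hom y')) ≫ eComp V x' y' z'
  simp only [MonoidalCategory.tensorHom_def, MonoidalCategory.comp_whiskerRight,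
    MonoidalCategory.whiskerLeft_comp, Category.assoc, eComp_elPost]
  have hm := elPre_eComp_middle j.inv x' z
  have hp := elPre_eComp i.inv y z
  rw [reassoc_of% hm, reassoc_of% h, reassoc_of% hp]

theorem eId_homIso {x x' : X} (i : (⟨x⟩ : Und X) ≅ ⟨x'⟩) :
    eId V x ≫ (homIso i i).hom = eId V x' := by
  change eId V x ≫ elPre i.inv x ≫ elPost i.hom x' = _
  rw [← Category.assoc, ← elComp_eq_pre, elComp_eId, ← elComp_eq_post]
  exact i.inv_hom_id

/-- The `V`-functor `X ⟶ full g` obtained by choosing, for each object `x`, an isomorphism with an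
object in the image of `g`; it acts on hom-objects by conjugation. -/
def fullRetract (s : X → T) (θ : ∀ x, (⟨x⟩ : Und X) ≅ ⟨g (s x)⟩) : X ⟶ full g where
  toFun :=
    { obj := s
      map := fun x y => (homIso (θ x) (θ y)).hom
      map_id := fun x => eId_homIso (θ x)
      map_comp := fun x y z => homIso_comp (θ x) (θ y) (θ z) }

/-- If every object of `X` is isomorphic to one in the image of `g`, then `X` is equivalent to
`full g`. -/
noncomputable def fullEquivalence (s : X → T) (θ : ∀ x, (⟨x⟩ : Und X) ≅ ⟨g (s x)⟩) : X ≌ full g :=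
  .mkOfAdjointifyCounit (f := fullRetract s θ) (g := fullι g)
    (isoOfComponents
      { app := fun x => (θ x).hom
        naturality := fun x y => by
          have h : 𝟙 _ ≫ elPost (θ y).hom x =
              ((elPre (θ x).inv y ≫ elPost (θ y).hom (g (s x))) ≫ 𝟙 _) ≫
                elPre (θ x).hom (g (s y)) := by
            have hp : elPre (θ x).inv y ≫ elPre (θ x).hom y = 𝟙 _ := (preIso (θ x) y).inv_hom_id
            rw [Category.comp_id, Category.assoc, elPost_elPre, reassoc_of% hp, Category.id_comp]
          exact h }
      θ (fun _ => rfl))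
    (isoOfComponents
      { app := fun t => (θ (g t)).inv
        naturality := fun t t' => by
          have h : (𝟙 _ ≫ elPre (θ (g t)).inv (g t') ≫ elPost (θ (g t')).hom (g (s (g t)))) ≫
              elPost (θ (g t')).inv (g (s (g t))) = 𝟙 _ ≫ elPre (θ (g t)).inv (g t') := by
            have hp : elPost (θ (g t')).hom (g (s (g t))) ≫ elPost (θ (g t')).inv (g (s (g t))) =
              𝟙 _ := (postIso (θ (g t')) _).hom_inv_id
            rw [Category.id_comp, Category.id_comp, Category.assoc, hp, Category.comp_id]
          exact h }
      (fun t =>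
        { hom := (θ (g t)).inv
          inv := (θ (g t)).hom
          hom_inv_id := (θ (g t)).inv_hom_id
          inv_hom_id := (θ (g t)).hom_inv_id })
      (fun _ => rfl))

end Full

section Replacement

variable (f : A ⟶ X)

/-- The objects of `A` together with the objects of `X` outside the essential image of
`f : A ⟶ X`. -/
abbrev ReplacementObj : Type u := A ⊕ {x : X // ¬ ∃ a, Nonempty ((⟨x⟩ : Und X) ≅ ⟨Fun.obj f a⟩)}

/-- The map to the objects of `X` that is `f` on `A`. -/
def replacementMap : ReplacementObj f → X := Sum.elim (Fun.obj f) Subtype.val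

/-- The `V`-category obtained from `X` by replacing the essential image of `f : A ⟶ X` by `A`. -/
abbrev replacement : VCat.{w, v, u} V := full (replacementMap f)

/-- The `V`-functor from `A` to the replacement of `X`. -/
def toReplacement : A ⟶ replacement f where
  toFun :=
    { obj := Sum.inl
      map := fun a b => Fun.map f a b
      map_id := fun a => (Fun.toFun f).map_id a
      map_comp := fun a b c => (Fun.toFun f).map_comp a b c }

theorem isFullInclusion_toReplacement (hf : FullyFaithful f) :
    IsFullInclusion (toReplacement f) :=
  ⟨Sum.inl_injective, hf⟩

/-- Each object of `X` is isomorphic to the image of a chosen object of the replacement: one of `A`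
if it lies in the essential image of `f`, and itself otherwise. -/
theorem equivalentUnder_toReplacement : EquivalentUnder f (toReplacement f) := by
  have h : ∀ x : X, ∃ t, Nonempty ((⟨x⟩ : Und X) ≅ ⟨replacementMap f t⟩) := fun x => by
    by_cases hx : ∃ a, Nonempty ((⟨x⟩ : Und X) ≅ ⟨Fun.obj f a⟩)
    · exact ⟨.inl hx.choose, hx.choose_spec⟩
    · exact ⟨.inr ⟨x, hx⟩, ⟨Iso.refl _⟩⟩
  choose s hs using h
  let e := fullEquivalence s fun x => (hs x).some
  let i : toReplacement f ≫ fullι (replacementMap f) ≅ f := isoOfComponents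
    { app := fun a => eId V (Fun.obj f a)
      naturality := fun a b => by
        have h : (Fun.map f a b ≫ 𝟙 _) ≫ elPost (eId V (Fun.obj f b)) _ =
            Fun.map f a b ≫ elPre (eId V (Fun.obj f a)) _ := by
          rw [elPost_id, elPre_id, Category.comp_id]
        exact h }
    (fun _ => Iso.refl _) (fun _ => rfl)
  exact ⟨e, ⟨whiskerRightIso i.symm e.hom ≪≫ α_ _ _ _ ≪≫
    whiskerLeftIso (toReplacement f) e.counit ≪≫ ρ_ _⟩⟩

theorem isSieve_toReplacement
    (h : ∀ x, (∃ a, Nonempty ((⟨x⟩ : Und X) ≅ ⟨Fun.obj f a⟩)) ∨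
      ∀ a, Nonempty (Limits.IsInitial (x ⟶[V] Fun.obj f a))) :
    IsSieve (Set.range (Fun.obj (toReplacement f))) := by
  rintro (a | x) hx _ ⟨b, rfl⟩
  · exact absurd ⟨a, rfl⟩ hx
  · exact (h x.1).resolve_left x.2 b

theorem isOpsieve_toReplacement
    (h : ∀ x, (∃ a, Nonempty ((⟨x⟩ : Und X) ≅ ⟨Fun.obj f a⟩)) ∨
      ∀ a, Nonempty (Limits.IsInitial (Fun.obj f a ⟶[V] x))) :
    IsOpsieve (Set.range (Fun.obj (toReplacement f))) := by
  rintro (a | x) hx _ ⟨b, rfl⟩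
  · exact absurd ⟨a, rfl⟩ hx
  · exact (h x.1).resolve_left x.2 b

end Replacement

/-! ### Cofibrations and coopfibrations -/

section Cofibration

variable [BraidedCategory V] [MonoidalClosed V] [Limits.HasInitial V] {f : A ⟶ X}

theorem fullyFaithful_of_isCofibration (hf : IsCofibration f) : FullyFaithful f := by
  obtain ⟨P, Q, c, l, adj, _⟩ := hf
  exact .of_comp (cosliceLeft_fullyFaithful_inl Q) (.of_iso c.isoL
    ((cosliceLeft_fullyFaithful_inl P).comp (fullyFaithful_of_isIso_counit adj)))

theorem fullyFaithful_of_isCoopfibration (hf : IsCoopfibration f) : FullyFaithful f := by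
  obtain ⟨P, Q, c, r, adj, _⟩ := hf
  exact .of_comp (cosliceRight_fullyFaithful_inr Q) (.of_iso c.isoR
    ((cosliceRight_fullyFaithful_inr P).comp (fullyFaithful_of_isIso_unit adj)))

/-- For a cofibration `f`, an object `x` outside its essential image has initial `X(x, f a)`. The
alternative is decided by where the left adjoint of `ubar` sends the first copy of `x` in
`X ↑ X`. -/
theorem exists_iso_or_isInitial_of_isCofibration (hf : IsCofibration f) (x : X) :
    (∃ a, Nonempty ((⟨x⟩ : Und X) ≅ ⟨Fun.obj f a⟩)) ∨
      ∀ a, Nonempty (Limits.IsInitial (x ⟶[V] Fun.obj f a)) := by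
  obtain ⟨P, Q, c, l, adj, _⟩ := hf
  obtain ⟨a, ⟨i⟩⟩ | ⟨y, ⟨i⟩⟩ := cosliceLeft_exists_iso P (Fun.obj l (Fun.obj Q.inl x))
  · left
    obtain ⟨hQ⟩ := cosliceLeft_corepresentableBy Q x
    obtain ⟨hP⟩ := cosliceLeft_corepresentableBy P a
    -- Both `x` and `f a` corepresent `y ↦ P(inl a, inr y)`.
    have hx := hQ.leftAdjoint (adjUnd adj) (undComp _ _ ≪≫ isoUnd c.isoR) i
    exact ⟨a, ⟨hx.uniqueUpToIso hP⟩⟩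
  · right
    intro a
    obtain ⟨hP⟩ := cosliceLeft_isInitial P a y
    have := cosliceLeft_fullyFaithful_inl Q x (Fun.obj f a)
    exact ⟨hP.ofIso (homIso i.symm (Iso.refl _) ≪≫ adjHomIso adj _ _ ≪≫
      homIso (Iso.refl _) (isoApp c.isoL a) ≪≫
      (@asIso _ _ _ _ (Fun.map Q.inl x (Fun.obj f a)) this).symm)⟩

/-- For a coopfibration `f`, an object `x` outside its essential image has initial `X(f a, x)`. The
alternative is decided by where the right adjoint of `ubar` sends the second copy of `x` in
`X ↑ X`. -/
theorem exists_iso_or_isInitial_of_isCoopfibration (hf : IsCoopfibration f) (x : X) :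
    (∃ a, Nonempty ((⟨x⟩ : Und X) ≅ ⟨Fun.obj f a⟩)) ∨
      ∀ a, Nonempty (Limits.IsInitial (Fun.obj f a ⟶[V] x)) := by
  obtain ⟨P, Q, c, r, adj, _⟩ := hf
  obtain ⟨y, ⟨i⟩⟩ | ⟨a, ⟨i⟩⟩ := cosliceRight_exists_iso P (Fun.obj r (Fun.obj Q.inr x))
  · right
    intro a
    obtain ⟨hP⟩ := cosliceRight_isInitial P y a
    have := cosliceRight_fullyFaithful_inr Q (Fun.obj f a) x
    exact ⟨hP.ofIso (homIso (Iso.refl _) i.symm ≪≫ (adjHomIso adj _ _).symm ≪≫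
      homIso (isoApp c.isoR a) (Iso.refl _) ≪≫
      (@asIso _ _ _ _ (Fun.map Q.inr (Fun.obj f a) x) this).symm)⟩
  · left
    obtain ⟨hQ⟩ := cosliceRight_representableBy Q x
    obtain ⟨hP⟩ := cosliceRight_representableBy P a
    -- Both `x` and `f a` represent `y ↦ P(inl y, inr a)`.
    have hx := hQ.rightAdjoint (adjUnd adj) (undComp _ _ ≪≫ isoUnd c.isoL) i
    exact ⟨a, ⟨hx.uniqueUpToIso hP⟩⟩

end Cofibration

end VCat

/-- A locally presentable category is cocomplete. -/
theorem CategoryTheory.hasInitial_of_isLocallyPresentable (V : Type v) [Category.{w} V]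
    [IsLocallyPresentable.{u} V] : Limits.HasInitial V := by
  obtain ⟨κ, _, _⟩ := IsLocallyPresentable.exists_cardinal.{u} V
  have : Limits.HasColimitsOfSize.{0, 0} V := Limits.hasColimitsOfSizeShrink.{0, 0, u, u} V
  infer_instance

theorem mainTheorem7 (V : Type v) [Category.{w} V] [MonoidalCategory V] [SymmetricCategory V]
    [MonoidalClosed V] [IsLocallyPresentable.{u} V] :
    (∀ {A X : VCat.{w, v, u} V} (f : A ⟶ X),
      Bicategory.IsCofibration f → VCat.FullyFaithful f) ∧
    (∀ {A X : VCat.{w, v, u} V} (f : A ⟶ X), Bicategory.IsCofibration f →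
      ∃ (Y : VCat.{w, v, u} V) (i : A ⟶ Y),
        VCat.IsSieveInclusion i ∧ Bicategory.EquivalentUnder f i) ∧
    (∀ {C Y : VCat.{w, v, u} V} (f : C ⟶ Y), Bicategory.IsCoopfibration f →
      ∃ (Z : VCat.{w, v, u} V) (i : C ⟶ Z),
        VCat.IsOpsieveInclusion i ∧ Bicategory.EquivalentUnder f i) := by
  have : Limits.HasInitial V := hasInitial_of_isLocallyPresentable.{w, v, u} V
  refine ⟨fun f hf => VCat.fullyFaithful_of_isCofibration hf, fun f hf => ?_, fun f hf => ?_⟩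
  · exact ⟨_, VCat.toReplacement f,
      ⟨VCat.isFullInclusion_toReplacement f (VCat.fullyFaithful_of_isCofibration hf),
        VCat.isSieve_toReplacement f (VCat.exists_iso_or_isInitial_of_isCofibration hf)⟩,
      VCat.equivalentUnder_toReplacement f⟩
  · exact ⟨_, VCat.toReplacement f,
      ⟨VCat.isFullInclusion_toReplacement f (VCat.fullyFaithful_of_isCoopfibration hf),
        VCat.isOpsieve_toReplacement f (VCat.exists_iso_or_isInitial_of_isCoopfibration hf)⟩,
      VCat.equivalentUnder_toReplacement f⟩
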